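/- Let $k$ be an algebraically closed field. A *finite abelian category* is a $k$-linear category that is $k$-linearly equivalent to the category of finite-dimensional modules over a finite-dimensional $k$-algebra. Let $\mathcal{C}$ be a finite tensor category over $k$, i.e. a rigid monoidal finite abelian category with $k$-bilinear tensor product and simple unit object, and let $\mathcal{M}$ be a finite left $\mathcal{C}$-module category, i.e. a finite abelian category with a left action $\mathcal{C}\times\mathcal{M}\to\mathcal{M}$, $(X,M)\mapsto X\otimes M$, that is $k$-linear and right exact in each variable. Associativity isomorphisms are suppressed. *Notation.* Let $\mathrm{Rex}(\mathcal{M})$ be the category of $k$-linear right exact endofunctors of $\mathcal{M}$, with the $\mathcal{C}$-bimodule structure $(X\otimes F)(M)=X\otimes F(M)$, $(F\otimes X)(M)=F(X\otimes M)$, and let $\rho:\mathcal{C}\to\mathrm{Rex}(\mathcal{M})$, $\rho(X)=X\otimes(-)$, be the action functor. Let $\mathrm{Rex}_{\mathcal{C}}(\mathcal{M})$ be the category of $k$-linear right exact left $\mathcal{C}$-module endofunctors $(F,s)$ of $\mathcal{M}$, with structure isomorphisms $s_{X,M}:X\otimes F(M)\to F(X\otimes M)$. Let $\mathcal{D}=\mathcal{C}_{\mathcal{M}}^*$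 be this category with the tensor product $F\otimes G=G\circ F$. The Drinfeld center $\mathcal{Z}(\mathcal{A})$ of a monoidal category $\mathcal{A}$ has as objects the pairs $(V,\sigma)$ of an object $V$ and a half-braiding $\sigma_X:V\otimes X\to X\otimes V$, and $\mathsf{U}$ denotes the functor forgetting $\sigma$. If $\rho^{\mathrm{ra}}$ is a right adjoint of $\rho$ with counit $\varepsilon_{F,M}:\rho^{\mathrm{ra}}(F)\otimes M\to F(M)$, let $$\xi^{(\ell)}_{X,F}:X\otimes\rho^{\mathrm{ra}}(F)\to\rho^{\mathrm{ra}}(X\otimes F),\qquad \xi^{(r)}_{F,X}:\rho^{\mathrm{ra}}(F)\otimes X\to\rho^{\mathrm{ra}}(F\otimes X)$$ be the isomorphisms that correspond under the adjunction to the natural transformations with components $\mathrm{id}_X\otimes\varepsilon_{F,M}$ and $\varepsilon_{F,X\otimes M}$. Define $\mathcal{Z}(\rho):\mathcal{Z}(\mathcal{C})\to\mathrm{Rex}_{\mathcal{C}}(\mathcal{M})$ by sending $(V,\sigma)$ to $\rho(V)$ with the module structure $\sigma_X^{-1}\otimes\mathrm{id}_M:X\otimes V\otimes M\to V\otimes X\otimes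 M$, and define $$\mathcal{Z}(\rho^{\mathrm{ra}}):\mathrm{Rex}_{\mathcal{C}}(\mathcal{M})\to\mathcal{Z}(\mathcal{C}),\qquad (F,s)\mapsto\big(\rho^{\mathrm{ra}}(F),\ (\xi^{(\ell)}_{X,F})^{-1}\circ\rho^{\mathrm{ra}}(s_X^{-1})\circ\xi^{(r)}_{F,X}\big).$$ Define $\Theta_{\mathcal{M}}:\mathcal{Z}(\mathcal{C})\to\mathcal{Z}(\mathcal{D})$ by sending $(V,\sigma)$ to $\mathcal{Z}(\rho)(V,\sigma)$ with the half-braiding whose component at $(F,s)$ is $s_{V,M}^{-1}:F(V\otimes M)\to V\otimes F(M)$. Both functors $\mathcal{Z}(\rho)$ and $\Theta_{\mathcal{M}}$ send a morphism $f$ to $f\otimes\mathrm{id}$, and $\mathcal{Z}(\rho^{\mathrm{ra}})$ sends $\phi$ to $\rho^{\mathrm{ra}}(\phi)$. **Theorem.** The functor $\rho$ has a right adjoint, and $\mathcal{M}$ has an internal Hom functor $\underline{\mathrm{Hom}}:\mathcal{M}^{\mathrm{op}}\times\mathcal{M}\to\mathcal{C}$, i.e. $\mathrm{Hom}_{\mathcal{M}}(X\otimes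 M,N)\cong\mathrm{Hom}_{\mathcal{C}}(X,\underline{\mathrm{Hom}}(M,N))$ naturally. For every right adjoint $\rho^{\mathrm{ra}}$ of $\rho$: 1. $\mathcal{Z}(\rho)$ is left adjoint to $\mathcal{Z}(\rho^{\mathrm{ra}})$, by an adjunction whose unit and counit have as underlying morphisms the unit and the counit of $\rho\dashv\rho^{\mathrm{ra}}$. 2. The composite $\mathsf{U}\circ\Theta_{\mathcal{M}}:\mathcal{Z}(\mathcal{C})\to\mathcal{C}_{\mathcal{M}}^*$ is left adjoint to $\mathcal{Z}(\rho^{\mathrm{ra}})$. 3. For every $F\in\mathrm{Rex}(\mathcal{M})$ the morphisms $\rho^{\mathrm{ra}}(F)\to\underline{\mathrm{Hom}}(M,F(M))$ that correspond to $\varepsilon_{F,M}$ form a universal wedge, so that $\rho^{\mathrm{ra}}(F)=\int_{M\in\mathcal{M}}\underline{\mathrm{Hom}}(M,F(M))$. 4. If $\mathcal{M}\neq 0$, then $\Theta_{\mathcal{M}}$ is an equivalence, $\mathsf{U}:\mathcal{Z}(\mathcal{D})\to\mathcal{D}$ has a right adjoint $\mathsf{U}^{\mathrm{ra}}$ (the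 induction), and $\Theta_{\mathcal{M}}^{-1}\circ\mathsf{U}^{\mathrm{ra}}\cong\mathcal{Z}(\rho^{\mathrm{ra}})$. Hence the composite $\mathcal{D}\to\mathcal{Z}(\mathcal{D})\to\mathcal{Z}(\mathcal{C})\to\mathcal{C}$ of $\mathsf{U}^{\mathrm{ra}}$, $\Theta_{\mathcal{M}}^{-1}$ and the forgetful functor sends $(F,s)$ to the end $\int_{M\in\mathcal{M}}\underline{\mathrm{Hom}}(M,F(M))$. -/

import Mathlib

open CategoryTheory Category MonoidalCategory Limits Opposite
open scoped MonoidalLeftAction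

universe v u u₁ u₂

namespace FinTensor

section Finite
variable (k : Type v) [Field k]

/-- A finite abelian category over `k`: a `k`-linear category that is `k`-linearly equivalent to
the category of finitely generated (equivalently, finite-dimensional) modules over a
finite-dimensional `k`-algebra. -/
class IsFiniteAbelian (A : Type u) [Category.{v} A] [Preadditive A] [Linear k A] : Prop where
  exists_equivalence : ∃ (R : Type v) (_ : Ring R) (_ : Algebra k R) (_ : Module.Finite k R)
    (e : A ≌ FGModuleCat.{v} R) (_ : e.functor.Additive), e.functor.Linear k

/-- A finite left module category over the `k`-linear monoidal category `C`: a finite abelian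
category with a left action of `C` that is `k`-linear and right exact in each variable. -/
class IsFiniteLeftModuleCategory
    (C : Type u₁) [Category.{v} C] [MonoidalCategory C] [Preadditive C] [Linear k C]
    (M : Type u₂) [Category.{v} M] [Preadditive M] [Linear k M]
    [MonoidalLeftAction C M] : Prop where
  finiteAbelian : IsFiniteAbelian k M
  additive_actionLeft (X : C) : (MonoidalLeftAction.actionLeft M X).Additive
  linear_actionLeft (X : C) : (MonoidalLeftAction.actionLeft M X).Linear k
  rightExact_actionLeft (X : C) : PreservesFiniteColimits (MonoidalLeftAction.actionLeft M X)
  additive_actionRight (m : M) : (MonoidalLeftAction.actionRight C m).Additive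
  linear_actionRight (m : M) : (MonoidalLeftAction.actionRight C m).Linear k
  rightExact_actionRight (m : M) : PreservesFiniteColimits (MonoidalLeftAction.actionRight C m)

end Finite

section Rex
variable (k : Type v) [Field k]
  (C : Type u₁) [Category.{v} C] [MonoidalCategory C] [Preadditive C] [Linear k C]
  (M : Type u₂) [Category.{v} M] [Preadditive M] [Linear k M]

/-- The endofunctor `F` of `M` is `k`-linear and right exact. -/
structure IsRex (F : M ⥤ M) : Prop where
  additive : F.Additive
  linear : F.Linear k
  rightExact : PreservesFiniteColimits F

/-- The category of `k`-linear right exact endofunctors of `M` and all natural transformations. -/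
abbrev Rex := ObjectProperty.FullSubcategory (C := M ⥤ M) (IsRex k M)

variable {k M}
lemma IsRex.id : IsRex k M (𝟭 M) := ⟨inferInstance, inferInstance, inferInstance⟩

lemma IsRex.comp {F G : M ⥤ M} (hF : IsRex k M F) (hG : IsRex k M G) : IsRex k M (F ⋙ G) := by
  obtain ⟨_, _, _⟩ := hF
  obtain ⟨_, _, _⟩ := hG
  exact ⟨inferInstance, inferInstance, Limits.comp_preservesFiniteColimits F G⟩

variable [MonoidalLeftAction C M] [IsFiniteLeftModuleCategory k C M]

variable {C} in
lemma IsRex.actionLeft (X : C) : IsRex k M (MonoidalLeftAction.actionLeft M X) :=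
  ⟨IsFiniteLeftModuleCategory.additive_actionLeft k X,
    IsFiniteLeftModuleCategory.linear_actionLeft X,
    IsFiniteLeftModuleCategory.rightExact_actionLeft k X⟩

variable (k M)
/-- The action functor `X ↦ X ⊗ -` from `C` to the category of `k`-linear right exact
endofunctors of `M`. -/
def act : C ⥤ Rex k M :=
  ObjectProperty.lift _ (MonoidalLeftAction.curriedAction C M) (fun X => IsRex.actionLeft X)

variable {k M C}
/-- The left action of `C` on right exact endofunctors: `(X ⊗ F)(m) = X ⊗ F(m)`. -/
def Rex.leftAct (X : C) (F : Rex k M) : Rex k M :=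
  ⟨F.obj ⋙ MonoidalLeftAction.actionLeft M X, F.property.comp (IsRex.actionLeft X)⟩

/-- The right action of `C` on right exact endofunctors: `(F ⊗ X)(m) = F(X ⊗ m)`. -/
def Rex.rightAct (F : Rex k M) (X : C) : Rex k M :=
  ⟨MonoidalLeftAction.actionLeft M X ⋙ F.obj, (IsRex.actionLeft X).comp F.property⟩
end Rex

section RexMod
variable (k : Type v) [Field k]
  (C : Type u₁) [Category.{v} C] [MonoidalCategory C]
  (M : Type u₂) [Category.{v} M] [Preadditive M] [Linear k M]
  [MonoidalLeftAction C M]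

/-- A `k`-linear right exact left `C`-module endofunctor of `M`, that is, a `k`-linear right exact
functor `F` with a coherent natural isomorphism `μₗ : X ⊗ F(m) ≅ F(X ⊗ m)` (inverse `δₗ`). -/
structure RexMod where
  toRex : Rex k M
  [leftLinear : toRex.obj.LeftLinear C]

attribute [instance] RexMod.leftLinear
namespace RexMod
open Functor.LaxLeftLinear Functor.OplaxLeftLinear
variable {k C M}

/-- A morphism of `C`-module functors: a natural transformation compatible with the module
structures. -/
@[ext]
structure Hom (F G : RexMod k C M) where
  nat : F.toRex ⟶ G.toRex
  comm (X : C) (m : M) :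
    X ⊴ₗ nat.hom.app m ≫ μₗ G.toRex.obj X m = μₗ F.toRex.obj X m ≫ nat.hom.app (X ⊙ₗ m) := by cat_disch

attribute [simp] Hom.comm

@[simp] lemma Hom.comm_assoc {F G : RexMod k C M} (f : Hom F G) (X : C) (m : M) {Z : M}
    (h : G.toRex.obj.obj (X ⊙ₗ m) ⟶ Z) :
    X ⊴ₗ f.nat.hom.app m ≫ μₗ G.toRex.obj X m ≫ h =
      μₗ F.toRex.obj X m ≫ f.nat.hom.app (X ⊙ₗ m) ≫ h := by
  rw [← Category.assoc, f.comm, Category.assoc]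

lemma Hom.comm_δ {F G : RexMod k C M} (f : Hom F G) (X : C) (m : M) :
    f.nat.hom.app (X ⊙ₗ m) ≫ δₗ G.toRex.obj X m = δₗ F.toRex.obj X m ≫ X ⊴ₗ f.nat.hom.app m := by
  rw [← cancel_epi (μₗ F.toRex.obj X m), ← f.comm_assoc]
  simp

instance : Category (RexMod k C M) where
  Hom F G := Hom F G
  id F := { nat := 𝟙 _ }
  comp f g := { nat := f.nat ≫ g.nat }

@[simp] lemma id_nat (F : RexMod k C M) : Hom.nat (𝟙 F) = 𝟙 F.toRex := rfl
@[simp] lemma comp_nat {F G H : RexMod k C M} (f : F ⟶ G) (g : G ⟶ H) :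
    (f ≫ g).nat = f.nat ≫ g.nat := rfl

@[ext] lemma hom_ext {F G : RexMod k C M} {f g : F ⟶ G}
    (h : ∀ m, f.nat.hom.app m = g.nat.hom.app m) : f = g :=
  Hom.ext (ObjectProperty.hom_ext _ (NatTrans.ext (funext h)))


/-- An isomorphism of module functors from its components. -/
def isoMk {F G : RexMod k C M} (e : ∀ m, F.toRex.obj.obj m ≅ G.toRex.obj.obj m)
    (nat : ∀ {m m' : M} (f : m ⟶ m'), F.toRex.obj.map f ≫ (e m').hom = (e m).hom ≫ G.toRex.obj.map f)
    (comm : ∀ (X : C) (m : M),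
      X ⊴ₗ (e m).hom ≫ μₗ G.toRex.obj X m = μₗ F.toRex.obj X m ≫ (e (X ⊙ₗ m)).hom) : F ≅ G where
  hom := { nat := ObjectProperty.homMk { app := fun m => (e m).hom } }
  inv :=
    { nat := ObjectProperty.homMk
        { app := fun m => (e m).inv
          naturality := fun m m' f => by
            rw [Iso.comp_inv_eq, Category.assoc, nat, Iso.inv_hom_id_assoc] }
      comm := fun X m => by
        dsimp
        rw [Iso.eq_comp_inv, Category.assoc, ← comm, ← MonoidalLeftAction.actionHomRight_comp_assoc,
          Iso.inv_hom_id, MonoidalLeftAction.actionHomRight_id, Category.id_comp] }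

/-- The identity functor as a module functor. -/
@[reducible]
def idLeftLinear : (𝟭 M).LeftLinear C where
  μₗ X m := 𝟙 _
  δₗ X m := 𝟙 _
  μₗ_comp_δₗ := by simp
  δₗ_comp_μₗ := by simp

/-- The module structure `X ⊗ GF(m) ≅ G(X ⊗ F(m)) ≅ GF(X ⊗ m)` of a composite. -/
@[reducible]
def compLeftLinear (F G : M ⥤ M) [F.LeftLinear C] [G.LeftLinear C] :
    (F ⋙ G).LeftLinear C where
  μₗ X m := μₗ G X (F.obj m) ≫ G.map (μₗ F X m)
  δₗ X m := G.map (δₗ F X m) ≫ δₗ G X (F.obj m)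
  μₗ_naturality_left f m := by simp [← Functor.map_comp]
  μₗ_naturality_right X _ _ f := by simp [← Functor.map_comp]
  μₗ_associativity X Y m := by
    have h := congrArg G.map (μₗ_associativity F X Y m)
    simp only [Functor.map_comp] at h
    simp only [Functor.comp_map, Functor.comp_obj, Category.assoc, h,
      MonoidalLeftAction.actionHomRight_comp, μₗ_associativity_assoc, μₗ_naturality_right_assoc]
  μₗ_unitality m := by simp [← Functor.map_comp]
  δₗ_naturality_left f m := by
    have h := congrArg G.map (δₗ_naturality_left F f m)
    simp only [Functor.map_comp] at h
    simp [reassoc_of% h]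
  δₗ_naturality_right X _ _ f := by
    have h := congrArg G.map (δₗ_naturality_right F X f)
    simp only [Functor.map_comp] at h
    simp [reassoc_of% h]
  δₗ_associativity X Y m := by
    have h := congrArg G.map (δₗ_associativity F X Y m)
    simp only [Functor.map_comp] at h
    simp only [Functor.comp_map, Functor.comp_obj, Category.assoc, reassoc_of% h,
      MonoidalLeftAction.actionHomRight_comp, δₗ_associativity, δₗ_naturality_right_assoc]
  δₗ_unitality_inv m := by
    have h := congrArg G.map (δₗ_unitality_inv F (C := C) m)
    simp only [Functor.map_comp] at h
    simp only [Functor.comp_map, Functor.comp_obj, ← reassoc_of% h]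
    exact δₗ_unitality_inv G (C := C) (F.obj m)
  μₗ_comp_δₗ X m := by
    have h := congrArg G.map (Functor.LeftLinear.μₗ_comp_δₗ F X m)
    simp only [Functor.map_comp] at h
    simp [reassoc_of% h]
  δₗ_comp_μₗ X m := by simp [← Functor.map_comp]

/-- The tensor product of the dual category of `C` with respect to `M` is the reversed composition:
`F ⊗ G` is `F` followed by `G`. -/
def tensorObj (F G : RexMod k C M) : RexMod k C M where
  toRex := ⟨F.toRex.obj ⋙ G.toRex.obj, F.toRex.property.comp G.toRex.property⟩
  leftLinear := compLeftLinear F.toRex.obj G.toRex.obj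

/-- The identity functor, the unit of the dual category. -/
def tensorUnit : RexMod k C M where
  toRex := ⟨𝟭 M, IsRex.id⟩
  leftLinear := idLeftLinear

@[simp] lemma tensorObj_μ (F G : RexMod k C M) (X : C) (m : M) :
    letI := compLeftLinear (C := C) F.toRex.obj G.toRex.obj
    μₗ (F.toRex.obj ⋙ G.toRex.obj) X m =
      μₗ G.toRex.obj X (F.toRex.obj.obj m) ≫ G.toRex.obj.map (μₗ F.toRex.obj X m) := rfl

/-- The monoidal structure for which `RexMod k C M` is the dual of `C` with respect to `M`. -/
instance : MonoidalCategoryStruct (RexMod k C M) where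
  tensorObj F G := tensorObj F G
  tensorUnit := tensorUnit
  whiskerLeft F G H f :=
    { nat := ObjectProperty.homMk (Functor.whiskerLeft F.toRex.obj f.nat.hom)
      comm X m := by
        change X ⊴ₗ f.nat.hom.app _ ≫ μₗ H.toRex.obj _ _ ≫ H.toRex.obj.map (μₗ F.toRex.obj _ _) =
          (μₗ G.toRex.obj _ _ ≫ G.toRex.obj.map (μₗ F.toRex.obj _ _)) ≫ f.nat.hom.app _
        simp }
  whiskerRight {F G} f H :=
    { nat := ObjectProperty.homMk (Functor.whiskerRight f.nat.hom H.toRex.obj)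
      comm X m := by
        change X ⊴ₗ H.toRex.obj.map (f.nat.hom.app _) ≫ μₗ H.toRex.obj _ _ ≫
            H.toRex.obj.map (μₗ G.toRex.obj _ _) =
          (μₗ H.toRex.obj _ _ ≫ H.toRex.obj.map (μₗ F.toRex.obj _ _)) ≫
            H.toRex.obj.map (f.nat.hom.app _)
        simp [← Functor.map_comp] }
  associator F G H := isoMk (fun m => Iso.refl _)
    (fun f => (Category.comp_id _).trans (Category.id_comp _).symm)
    (fun X m => by
      change X ⊴ₗ 𝟙 _ ≫ (μₗ H.toRex.obj X (G.toRex.obj.obj (F.toRex.obj.obj m)) ≫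
        H.toRex.obj.map (μₗ G.toRex.obj X (F.toRex.obj.obj m))) ≫
          H.toRex.obj.map (G.toRex.obj.map (μₗ F.toRex.obj X m)) =
       (μₗ H.toRex.obj X (G.toRex.obj.obj (F.toRex.obj.obj m)) ≫
        H.toRex.obj.map (μₗ G.toRex.obj X (F.toRex.obj.obj m) ≫
          G.toRex.obj.map (μₗ F.toRex.obj X m))) ≫ 𝟙 _
      simp)
  leftUnitor F := isoMk (fun m => Iso.refl _)
    (fun f => (Category.comp_id _).trans (Category.id_comp _).symm)
    (fun X m => by
      change X ⊴ₗ 𝟙 _ ≫ μₗ F.toRex.obj X m = (μₗ F.toRex.obj X m ≫ F.toRex.obj.map (𝟙 _)) ≫ 𝟙 _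
      simp)
  rightUnitor F := isoMk (fun m => Iso.refl _)
    (fun f => (Category.comp_id _).trans (Category.id_comp _).symm)
    (fun X m => by
      change X ⊴ₗ 𝟙 _ ≫ μₗ F.toRex.obj X m = (𝟙 _ ≫ μₗ F.toRex.obj X m) ≫ 𝟙 _
      simp)

section
variable (F G H : RexMod k C M) (m : M)
@[simp] lemma tensor_obj : (F ⊗ G).toRex.obj.obj m = G.toRex.obj.obj (F.toRex.obj.obj m) := rfl
@[simp] lemma tensor_map {m m' : M} (f : m ⟶ m') :
    (F ⊗ G).toRex.obj.map f = G.toRex.obj.map (F.toRex.obj.map f) := rfl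
@[simp] lemma unit_obj : (𝟙_ (RexMod k C M)).toRex.obj.obj m = m := rfl
@[simp] lemma unit_map {m m' : M} (f : m ⟶ m') :
    (𝟙_ (RexMod k C M)).toRex.obj.map f = f := rfl
@[simp] lemma whiskerLeft_app (f : G ⟶ H) :
    (F ◁ f).nat.hom.app m = f.nat.hom.app (F.toRex.obj.obj m) := rfl
@[simp] lemma whiskerRight_app (f : F ⟶ G) :
    (f ▷ H).nat.hom.app m = H.toRex.obj.map (f.nat.hom.app m) := rfl
@[simp] lemma associator_hom_app : (α_ F G H).hom.nat.hom.app m = 𝟙 _ := rfl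
@[simp] lemma associator_inv_app : (α_ F G H).inv.nat.hom.app m = 𝟙 _ := rfl
@[simp] lemma leftUnitor_hom_app : (λ_ F).hom.nat.hom.app m = 𝟙 _ := rfl
@[simp] lemma rightUnitor_hom_app : (ρ_ F).hom.nat.hom.app m = 𝟙 _ := rfl
@[simp] lemma leftUnitor_inv_app : (λ_ F).inv.nat.hom.app m = 𝟙 _ := rfl
@[simp] lemma rightUnitor_inv_app : (ρ_ F).inv.nat.hom.app m = 𝟙 _ := rfl
end

@[simp] lemma tensorHom_app {F F' G G' : RexMod k C M} (f : F ⟶ F') (g : G ⟶ G') (m : M) :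
    (f ⊗ₘ g).nat.hom.app m =
      G.toRex.obj.map (f.nat.hom.app m) ≫ g.nat.hom.app (F'.toRex.obj.obj m) := rfl

instance : MonoidalCategory (RexMod k C M) where
  tensorHom_def _ _ := by ext; simp
  id_tensorHom_id _ _ := by ext; simp
  tensorHom_comp_tensorHom _ _ _ _ := by ext; simp
  whiskerLeft_id _ _ := by ext; simp
  id_whiskerRight _ _ := by ext; simp
  associator_naturality _ _ _ := by ext; simp [← Functor.map_comp]
  leftUnitor_naturality _ := by ext; simp
  rightUnitor_naturality _ := by ext; simp
  pentagon _ _ _ _ := by ext; simp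
  triangle _ G := by
    ext
    simp only [comp_nat, ObjectProperty.FullSubcategory.comp_hom, NatTrans.comp_app,
      associator_hom_app, whiskerLeft_app, whiskerRight_app, leftUnitor_hom_app,
      rightUnitor_hom_app]
    exact (Category.comp_id _).trans (G.toRex.obj.map_id _).symm

end RexMod
end RexMod

section Schauenburg
open Functor.LaxLeftLinear Functor.OplaxLeftLinear MonoidalLeftAction
variable {C : Type u₁} [Category.{v} C] [MonoidalCategory C]
  {M : Type u₂} [Category.{v} M] [MonoidalLeftAction C M]

lemma leftLinear_unit (F : M ⥤ M) (s : ∀ (X : C) (m : M), F.obj (X ⊙ₗ m) ≅ X ⊙ₗ F.obj m)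
    (h₁ : ∀ {X Y : C} (f : X ⟶ Y) (m : M),
      F.map (f ⊵ₗ m) ≫ (s Y m).hom = (s X m).hom ≫ f ⊵ₗ F.obj m)
    (h₂ : ∀ (X : C) {m m' : M} (f : m ⟶ m'),
      F.map (X ⊴ₗ f) ≫ (s X m').hom = (s X m).hom ≫ X ⊴ₗ F.map f)
    (h₃ : ∀ (X Y : C) (m : M), (s (X ⊗ Y) m).hom ≫ (αₗ X Y (F.obj m)).hom =
      F.map (αₗ X Y m).hom ≫ (s X (Y ⊙ₗ m)).hom ≫ X ⊴ₗ (s Y m).hom) (m : M) :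
    (s (𝟙_ C) m).hom ≫ (λₗ (F.obj m)).hom = F.map (λₗ m).hom := by
  have key : (s (𝟙_ C) (𝟙_ C ⊙ₗ m)).hom ≫ (λₗ (F.obj (𝟙_ C ⊙ₗ m))).hom =
      F.map (λₗ (𝟙_ C ⊙ₗ m)).hom := by
    have e₁ := h₁ (λ_ (𝟙_ C)).hom m
    have e₃ := h₃ (𝟙_ C) (𝟙_ C) m
    rw [leftUnitor_actionHom, leftUnitor_actionHom, reassoc_of% e₃, Functor.map_comp,
      Category.assoc, ← cancel_epi (F.map (αₗ (𝟙_ C) (𝟙_ C) m).inv)] at e₁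
    rw [← actionUnitIso_hom_naturality, ← Functor.map_comp_assoc, Iso.inv_hom_id,
      CategoryTheory.Functor.map_id, Category.id_comp, ← Functor.map_comp_assoc, Iso.inv_hom_id,
      CategoryTheory.Functor.map_id, Category.id_comp] at e₁
    rw [← cancel_mono (s (𝟙_ C) m).hom, Category.assoc]
    exact e₁.symm
  have n := h₂ (𝟙_ C) (λₗ[C] m).hom
  rw [← cancel_epi (F.map ((𝟙_ C) ⊴ₗ (λₗ[C] m).hom)), reassoc_of% n,
    ← actionUnitIso_hom_naturality, reassoc_of% key, ← Functor.map_comp, ← Functor.map_comp,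
    actionUnitIso_hom_naturality]

/-- A module structure from natural isomorphisms `F(X ⊗ m) ≅ X ⊗ F(m)` that satisfy the hexagon
condition; the unit condition is a consequence. -/
@[reducible]
def leftLinearOfIso (F : M ⥤ M) (s : ∀ (X : C) (m : M), F.obj (X ⊙ₗ m) ≅ X ⊙ₗ F.obj m)
    (h₁ : ∀ {X Y : C} (f : X ⟶ Y) (m : M),
      F.map (f ⊵ₗ m) ≫ (s Y m).hom = (s X m).hom ≫ f ⊵ₗ F.obj m)
    (h₂ : ∀ (X : C) {m m' : M} (f : m ⟶ m'),
      F.map (X ⊴ₗ f) ≫ (s X m').hom = (s X m).hom ≫ X ⊴ₗ F.map f)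
    (h₃ : ∀ (X Y : C) (m : M), (s (X ⊗ Y) m).hom ≫ (αₗ X Y (F.obj m)).hom =
      F.map (αₗ X Y m).hom ≫ (s X (Y ⊙ₗ m)).hom ≫ X ⊴ₗ (s Y m).hom) :
    F.LeftLinear C where
  μₗ X m := (s X m).inv
  δₗ X m := (s X m).hom
  μₗ_naturality_left f m := by rw [Iso.eq_inv_comp, ← reassoc_of% h₁]; simp
  μₗ_naturality_right X _ _ f := by rw [Iso.eq_inv_comp, ← reassoc_of% h₂]; simp
  μₗ_associativity X Y m := by
    rw [Iso.inv_comp_eq, reassoc_of% h₃, ← actionHomRight_comp_assoc]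
    simp
  μₗ_unitality m := by rw [← leftLinear_unit F s h₁ h₂ h₃]; simp
  μₗ_comp_δₗ _ _ := Iso.inv_hom_id _
  δₗ_comp_μₗ _ _ := Iso.hom_inv_id _
  δₗ_naturality_left := h₁
  δₗ_naturality_right := h₂
  δₗ_associativity := h₃
  δₗ_unitality_inv m := by
    rw [← cancel_mono (λₗ (F.obj m)).hom, Category.assoc, leftLinear_unit F s h₁ h₂ h₃,
      ← Functor.map_comp]
    simp

lemma associator_act (X Y Z : C) (m : M) : (α_ X Y Z).hom ⊵ₗ m =
    (αₗ (X ⊗ Y) Z m).hom ≫ (αₗ X Y (Z ⊙ₗ m)).hom ≫ X ⊴ₗ (αₗ Y Z m).inv ≫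
      (αₗ X (Y ⊗ Z) m).inv := by
  rw [← associator_actionHom_assoc]
  simp

lemma assoc_hom_naturality (X Y : C) {m m' : M} (f : m ⟶ m') :
    (αₗ X Y m).hom ≫ X ⊴ₗ Y ⊴ₗ f = (X ⊗ Y) ⊴ₗ f ≫ (αₗ X Y m').hom := by simp

lemma assoc_inv_naturality (X Y : C) {m m' : M} (f : m ⟶ m') :
    X ⊴ₗ Y ⊴ₗ f ≫ (αₗ X Y m').inv = (αₗ X Y m).inv ≫ (X ⊗ Y) ⊴ₗ f := by simp

lemma leftUnitor_inv_act (X : C) (m : M) :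
    (λ_ X).inv ⊵ₗ m = (λₗ (X ⊙ₗ m)).inv ≫ (αₗ (𝟙_ C) X m).inv := by
  rw [← cancel_epi ((λ_ X).hom ⊵ₗ m), ← comp_actionHomLeft, Iso.hom_inv_id, id_actionHomLeft]
  simp

lemma rightUnitor_inv_act (X : C) (m : M) :
    (ρ_ X).inv ⊵ₗ m = X ⊴ₗ (λₗ m).inv ≫ (αₗ X (𝟙_ C) m).inv := by
  rw [← cancel_epi ((ρ_ X).hom ⊵ₗ m), ← comp_actionHomLeft, Iso.hom_inv_id, id_actionHomLeft]
  simp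

lemma associator_inv_act (X Y Z : C) (m : M) : (α_ X Y Z).inv ⊵ₗ m =
    (αₗ X (Y ⊗ Z) m).hom ≫ X ⊴ₗ (αₗ Y Z m).hom ≫ (αₗ X Y (Z ⊙ₗ m)).inv ≫
      (αₗ (X ⊗ Y) Z m).inv := by
  rw [← cancel_epi ((α_ X Y Z).hom ⊵ₗ m), ← comp_actionHomLeft, Iso.hom_inv_id,
    id_actionHomLeft, associator_actionHom_assoc]
  simp

lemma zigzag₁ (X D : C) [ExactPairing X D] (m : M) :
    (λₗ (X ⊙ₗ m)).inv ≫ (η_ X D) ⊵ₗ (X ⊙ₗ m) ≫ (αₗ X D (X ⊙ₗ m)).hom ≫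
      X ⊴ₗ ((αₗ D X m).inv ≫ (ε_ X D) ⊵ₗ m ≫ (λₗ m).hom) = 𝟙 _ := by
  have e := congrArg (· ⊵ₗ m) (ExactPairing.evaluation_coevaluation X D)
  simp only [comp_actionHomLeft, whiskerLeft_actionHomLeft, whiskerRight_actionHomLeft,
    associator_act, leftUnitor_actionHom, rightUnitor_inv_act, Category.assoc,
    Iso.inv_hom_id_assoc] at e
  replace e := congrArg (· ≫ (αₗ X (𝟙_ C) m).hom ≫ X ⊴ₗ (λₗ m).hom) ((cancel_epi _).1 e)
  simp only [Category.assoc, Iso.inv_hom_id_assoc, actionHomRight_inv_hom, Category.comp_id] at e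
  rw [Iso.inv_comp_eq, Category.comp_id, ← e]
  simp only [actionHomRight_comp]

lemma zigzag₂ (X D : C) [ExactPairing X D] (m : M) :
    D ⊴ₗ ((λₗ m).inv ≫ (η_ X D) ⊵ₗ m ≫ (αₗ X D m).hom) ≫ (αₗ D X (D ⊙ₗ m)).inv ≫
      (ε_ X D) ⊵ₗ (D ⊙ₗ m) ≫ (λₗ (D ⊙ₗ m)).hom = 𝟙 _ := by
  have e := congrArg (· ⊵ₗ m) (ExactPairing.coevaluation_evaluation X D)
  simp only [comp_actionHomLeft, whiskerLeft_actionHomLeft, whiskerRight_actionHomLeft,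
    associator_inv_act, leftUnitor_inv_act, rightUnitor_actionHom, Category.assoc,
    Iso.inv_hom_id_assoc] at e
  replace e := congrArg (· ≫ (αₗ (𝟙_ C) D m).hom ≫ (λₗ (D ⊙ₗ m)).hom) ((cancel_epi _).1 e)
  simp only [Category.assoc, Iso.inv_hom_id_assoc, Iso.inv_hom_id, Category.comp_id] at e
  rw [actionHomRight_comp, actionHomRight_comp, Category.assoc, Category.assoc, e,
    actionHomRight_inv_hom]

section
variable {V : C} (b : HalfBraiding V)

/-- The isomorphism `σ_X ⊗ m : V ⊗ X ⊗ m ≅ X ⊗ V ⊗ m` induced by a half-braiding `σ` of `V`. -/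
@[simps]
def braidAct (X : C) (m : M) : V ⊙ₗ X ⊙ₗ m ≅ X ⊙ₗ V ⊙ₗ m where
  hom := (αₗ V X m).inv ≫ (b.β X).hom ⊵ₗ m ≫ (αₗ X V m).hom
  inv := (αₗ X V m).inv ≫ (b.β X).inv ⊵ₗ m ≫ (αₗ V X m).hom

lemma braidAct_naturality_left {X Y : C} (f : X ⟶ Y) (m : M) :
    V ⊴ₗ f ⊵ₗ m ≫ (braidAct b Y m).hom = (braidAct b X m).hom ≫ f ⊵ₗ (V ⊙ₗ m) := by
  have e := congrArg (· ⊵ₗ m) (b.naturality f)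
  simp only [comp_actionHomLeft, whiskerLeft_actionHomLeft, whiskerRight_actionHomLeft,
    Category.assoc] at e
  rw [← cancel_epi (αₗ V X m).hom]
  simp only [braidAct_hom, Category.assoc, Iso.hom_inv_id_assoc, reassoc_of% e,
    Iso.inv_hom_id, Category.comp_id]

lemma braidAct_naturality_right (X : C) {m m' : M} (f : m ⟶ m') :
    V ⊴ₗ X ⊴ₗ f ≫ (braidAct b X m').hom = (braidAct b X m).hom ≫ X ⊴ₗ V ⊴ₗ f := by
  have e := action_exchange (b.β X).hom f
  simp only [tensor_actionHomRight, Category.assoc] at e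
  rw [← cancel_epi (αₗ V X _).hom]
  simp only [braidAct_hom, Category.assoc, Iso.hom_inv_id_assoc, reassoc_of% e,
    Iso.inv_hom_id, Category.comp_id]

lemma braidAct_tensor (X Y : C) (m : M) :
    (braidAct b (X ⊗ Y) m).hom ≫ (αₗ X Y (V ⊙ₗ m)).hom =
      V ⊴ₗ (αₗ X Y m).hom ≫ (braidAct b X (Y ⊙ₗ m)).hom ≫ X ⊴ₗ (braidAct b Y m).hom := by
  rw [braidAct_hom, b.monoidal]
  simp only [comp_actionHomLeft, whiskerLeft_actionHomLeft, whiskerRight_actionHomLeft,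
    associator_act, associator_inv_act, braidAct_hom, actionHomRight_comp, Category.assoc,
    Iso.inv_hom_id_assoc, Iso.inv_hom_id, Category.comp_id]

end

lemma braidAct_hom_naturality {V W : Center C} (f : V ⟶ W) (X : C) (m : M) :
    f.f ⊵ₗ (X ⊙ₗ m) ≫ (braidAct W.2 X m).hom = (braidAct V.2 X m).hom ≫ X ⊴ₗ f.f ⊵ₗ m := by
  have e := congrArg (· ⊵ₗ m) (f.comm X)
  simp only [comp_actionHomLeft, whiskerLeft_actionHomLeft, whiskerRight_actionHomLeft,
    Category.assoc] at e
  rw [← cancel_epi (αₗ V.1 X m).hom]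
  simp only [braidAct_hom, Category.assoc, Iso.hom_inv_id_assoc, reassoc_of% e,
    Iso.inv_hom_id, Category.comp_id]

section
variable {V : C} (b : HalfBraiding V)

lemma map_braidAct (F : M ⥤ M) [F.LeftLinear C] (X : C) (m : M) :
    F.map (braidAct b X m).hom ≫ δₗ F X (V ⊙ₗ m) ≫ X ⊴ₗ δₗ F V m =
      δₗ F V (X ⊙ₗ m) ≫ V ⊴ₗ δₗ F X m ≫ (braidAct b X (F.obj m)).hom := by
  have e := δₗ_naturality_left F (b.β X).hom m
  simp only [braidAct_hom, Functor.map_comp, Category.assoc]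
  rw [← δₗ_associativity, reassoc_of% e, δₗ_associativity_inv_assoc]

end
end Schauenburg

section Functors
open Functor.LaxLeftLinear Functor.OplaxLeftLinear MonoidalLeftAction
variable (k : Type v) [Field k]
  {C : Type u₁} [Category.{v} C] [MonoidalCategory C] [Preadditive C] [Linear k C]
  (M : Type u₂) [Category.{v} M] [Preadditive M] [Linear k M]
  [MonoidalLeftAction C M] [IsFiniteLeftModuleCategory k C M]

/-- For a half-braiding `σ` of `V`, the functor `V ⊗ -` with the module structure
`σ_X⁻¹ ⊗ m : X ⊗ V ⊗ m ⟶ V ⊗ X ⊗ m`. -/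
def braidedAct {V : C} (b : HalfBraiding V) : RexMod k C M where
  toRex := (act k C M).obj V
  leftLinear := leftLinearOfIso (actionLeft M V) (braidAct b) (braidAct_naturality_left b)
    (braidAct_naturality_right b) (braidAct_tensor b)

section
variable {k M}
variable {V : C} (b : HalfBraiding V) (X : C) (m : M)
@[simp] lemma braidedAct_obj : (braidedAct k M b).toRex.obj.obj m = V ⊙ₗ m := rfl
@[simp] lemma braidedAct_map {m m' : M} (f : m ⟶ m') :
    (braidedAct k M b).toRex.obj.map f = V ⊴ₗ f := rfl
@[simp] lemma braidedAct_μ : μₗ (braidedAct k M b).toRex.obj X m = (braidAct b X m).inv := rfl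
@[simp] lemma braidedAct_δ : δₗ (braidedAct k M b).toRex.obj X m = (braidAct b X m).hom := rfl
end

/-- The half-braiding of `V ⊗ -` in the dual category. Its component at a module functor `F` is
`δₗ : F(V ⊗ m) ≅ V ⊗ F(m)`, the inverse of the module structure of `F`. -/
def braidedActHalfBraiding {V : C} (b : HalfBraiding V) : HalfBraiding (braidedAct k M b) where
  β F := RexMod.isoMk (fun m => (Functor.LeftLinear.μₗIso F.toRex.obj V m).symm)
    (fun {m m'} f => δₗ_naturality_right F.toRex.obj V f)
    (fun X m => by
      change X ⊴ₗ δₗ F.toRex.obj V m ≫ (braidAct b X (F.toRex.obj.obj m)).inv ≫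
          V ⊴ₗ μₗ F.toRex.obj X m =
        (μₗ F.toRex.obj X (V ⊙ₗ m) ≫ F.toRex.obj.map (braidAct b X m).inv) ≫
          δₗ F.toRex.obj V (X ⊙ₗ m)
      have e := map_braidAct b F.toRex.obj X m
      rw [← cancel_epi (δₗ F.toRex.obj X (V ⊙ₗ m)),
        ← cancel_epi (F.toRex.obj.map (braidAct b X m).hom), reassoc_of% e]
      rw [Category.assoc, Functor.LeftLinear.δₗ_comp_μₗ_assoc, Iso.map_hom_inv_id_assoc,
        Iso.hom_inv_id_assoc, ← actionHomRight_comp, Functor.LeftLinear.δₗ_comp_μₗ, actionHomRight_id,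
        Category.comp_id])
  monoidal F G := by
    ext m
    simp [RexMod.isoMk]
    rfl
  naturality {F G} f := by
    ext m
    exact f.comm_δ V m

variable (C) in
/-- The lift of the action functor to the Drinfeld center: `(V, σ)` goes to the functor `V ⊗ -` with
the module structure `σ⁻¹ ⊗ m`. -/
def centerAct : Center C ⥤ RexMod k C M where
  obj V := braidedAct k M V.2
  map {V W} f :=
    { nat := (act k C M).map f.f
      comm X m := by
        change X ⊴ₗ f.f ⊵ₗ m ≫ (braidAct W.2 X m).inv = (braidAct V.2 X m).inv ≫ f.f ⊵ₗ (X ⊙ₗ m)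
        rw [Iso.comp_inv_eq, Category.assoc, Iso.eq_inv_comp]
        exact (braidAct_hom_naturality f X m).symm }
  map_id _ := by
    ext m
    exact id_actionHomLeft _ _
  map_comp _ _ := by
    ext m
    exact comp_actionHomLeft _ _ _

variable (C) in
/-- Schauenburg's functor from the Drinfeld center of `C` to the Drinfeld center of the dual
category: `(V, σ)` goes to the module functor `V ⊗ -` (with structure `σ⁻¹ ⊗ m`) with the
half-braiding given by the module structures of the objects of the dual category. -/
def schauenburg : Center C ⥤ Center (RexMod k C M) where
  obj V := ⟨(centerAct k C M).obj V, braidedActHalfBraiding k M V.2⟩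
  map {V W} f :=
    { f := (centerAct k C M).map f
      comm F := by
        ext m
        exact δₗ_naturality_left F.toRex.obj f.f m }
  map_id V := Center.ext _ _ ((centerAct k C M).map_id V)
  map_comp f g := Center.ext _ _ ((centerAct k C M).map_comp f g)

variable {k M}
section
variable {R : Rex k M ⥤ C} (adj : act k C M ⊣ R)

/-- The component `ε_{F, m} : R(F) ⊗ m ⟶ F(m)` of the counit. -/
def counitApp (F : Rex k M) (m : M) : R.obj F ⊙ₗ m ⟶ F.obj.obj m :=
  (adj.counit.app F).hom.app m

lemma counitApp_naturality (F : Rex k M) {m m' : M} (f : m ⟶ m') :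
    R.obj F ⊴ₗ f ≫ counitApp adj F m' = counitApp adj F m ≫ F.obj.map f :=
  (adj.counit.app F).hom.naturality f

lemma map_counitApp {F G : Rex k M} (φ : F ⟶ G) (m : M) :
    (R.map φ) ⊵ₗ m ≫ counitApp adj G m = counitApp adj F m ≫ φ.hom.app m :=
  congrArg (fun u => u.hom.app m) (adj.counit.naturality φ)

/-- The morphism `W ⟶ R(F)` that corresponds to a natural transformation `W ⊗ m ⟶ F(m)`. -/
def mate {W : C} {F : Rex k M} (t : ∀ m : M, W ⊙ₗ m ⟶ F.obj.obj m)
    (ht : ∀ {m m' : M} (f : m ⟶ m'), W ⊴ₗ f ≫ t m' = t m ≫ F.obj.map f) : W ⟶ R.obj F :=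
  adj.homEquiv W F (ObjectProperty.homMk { app := t, naturality := fun _ _ f => ht f })

lemma mate_app {W : C} {F : Rex k M} (t : ∀ m : M, W ⊙ₗ m ⟶ F.obj.obj m)
    (ht : ∀ {m m' : M} (f : m ⟶ m'), W ⊴ₗ f ≫ t m' = t m ≫ F.obj.map f) (m : M) :
    (mate adj t ht) ⊵ₗ m ≫ counitApp adj F m = t m := by
  have h := (adj.homEquiv W F).symm_apply_apply
    (ObjectProperty.homMk { app := t, naturality := fun _ _ f => ht f })
  rw [adj.homEquiv_counit] at h
  exact congrArg (fun u => u.hom.app m) h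

lemma mate_ext {W : C} {F : Rex k M} {a b : W ⟶ R.obj F}
    (h : ∀ m : M, a ⊵ₗ m ≫ counitApp adj F m = b ⊵ₗ m ≫ counitApp adj F m) : a = b := by
  apply (adj.homEquiv W F).symm.injective
  rw [adj.homEquiv_counit, adj.homEquiv_counit]
  ext m
  exact h m

/-- The counit at `X ⊗ F`. -/
def counitL (X : C) (F : Rex k M) (m : M) : R.obj (F.leftAct X) ⊙ₗ m ⟶ X ⊙ₗ F.obj.obj m :=
  counitApp adj (F.leftAct X) m

lemma counitL_naturality (X : C) (F : Rex k M) {m m' : M} (f : m ⟶ m') :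
    R.obj (F.leftAct X) ⊴ₗ f ≫ counitL adj X F m' = counitL adj X F m ≫ X ⊴ₗ F.obj.map f :=
  counitApp_naturality adj _ f

/-- The counit at `F ⊗ X`. -/
def counitR (F : Rex k M) (X : C) (m : M) : R.obj (F.rightAct X) ⊙ₗ m ⟶ F.obj.obj (X ⊙ₗ m) :=
  counitApp adj (F.rightAct X) m

lemma counitR_naturality (F : Rex k M) (X : C) {m m' : M} (f : m ⟶ m') :
    R.obj (F.rightAct X) ⊴ₗ f ≫ counitR adj F X m' =
      counitR adj F X m ≫ F.obj.map (X ⊴ₗ f) :=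
  counitApp_naturality adj _ f

lemma leftStr_aux (X : C) (F : Rex k M) {m m' : M} (f : m ⟶ m') :
    (X ⊗ R.obj F) ⊴ₗ f ≫ (αₗ X (R.obj F) m').hom ≫ X ⊴ₗ counitApp adj F m' =
      ((αₗ X (R.obj F) m).hom ≫ X ⊴ₗ counitApp adj F m) ≫ X ⊴ₗ F.obj.map f := by
  simp only [tensor_actionHomRight, Category.assoc, Iso.inv_hom_id_assoc,
    ← actionHomRight_comp, counitApp_naturality]

lemma rightStr_aux (F : Rex k M) (X : C) {m m' : M} (f : m ⟶ m') :
    (R.obj F ⊗ X) ⊴ₗ f ≫ (αₗ (R.obj F) X m').hom ≫ counitApp adj F (X ⊙ₗ m') =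
      ((αₗ (R.obj F) X m).hom ≫ counitApp adj F (X ⊙ₗ m)) ≫ F.obj.map (X ⊴ₗ f) := by
  simp only [tensor_actionHomRight, Category.assoc, Iso.inv_hom_id_assoc, counitApp_naturality]

/-- The left module structure `X ⊗ R(F) ⟶ R(X ⊗ F)` of the right adjoint `R`, for which the counit
is a morphism of left module functors: it corresponds to `X ⊗ ε_{F, m}`. -/
def leftStr (X : C) (F : Rex k M) : X ⊗ R.obj F ⟶ R.obj (F.leftAct X) :=
  mate adj (F := F.leftAct X) (fun m => (αₗ X (R.obj F) m).hom ≫ X ⊴ₗ counitApp adj F m)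
    (leftStr_aux adj X F)

/-- The right module structure `R(F) ⊗ X ⟶ R(F ⊗ X)` of the right adjoint `R`, for which the
counit is a morphism of right module functors: it corresponds to `ε_{F, X ⊗ m}`. -/
def rightStr (F : Rex k M) (X : C) : R.obj F ⊗ X ⟶ R.obj (F.rightAct X) :=
  mate adj (F := F.rightAct X) (fun m => (αₗ (R.obj F) X m).hom ≫ counitApp adj F (X ⊙ₗ m))
    (rightStr_aux adj F X)

lemma leftStr_app (X : C) (F : Rex k M) (m : M) :
    leftStr adj X F ⊵ₗ m ≫ counitL adj X F m =
      (αₗ X (R.obj F) m).hom ≫ X ⊴ₗ counitApp adj F m :=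
  mate_app adj _ _ m

lemma rightStr_app (F : Rex k M) (X : C) (m : M) :
    rightStr adj F X ⊵ₗ m ≫ counitR adj F X m =
      (αₗ (R.obj F) X m).hom ≫ counitApp adj F (X ⊙ₗ m) :=
  mate_app adj _ _ m

section
variable (X D : C) [ExactPairing X D] (F : Rex k M)

lemma leftStrAux_aux {m m' : M} (f : m ⟶ m') :
    (D ⊗ R.obj (F.leftAct X)) ⊴ₗ f ≫ (αₗ _ _ m').hom ≫ D ⊴ₗ counitL adj X F m' ≫
      (αₗ D X (F.obj.obj m')).inv ≫ (ε_ X D) ⊵ₗ (F.obj.obj m') ≫ (λₗ _).hom =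
    ((αₗ _ _ m).hom ≫ D ⊴ₗ counitL adj X F m ≫
      (αₗ D X (F.obj.obj m)).inv ≫ (ε_ X D) ⊵ₗ (F.obj.obj m) ≫ (λₗ _).hom) ≫ F.obj.map f := by
  have e := action_exchange (ε_ X D) (F.obj.map f)
  rw [← reassoc_of% assoc_hom_naturality, ← actionHomRight_comp_assoc, counitL_naturality,
    actionHomRight_comp_assoc, reassoc_of% assoc_inv_naturality, reassoc_of% e,
    ← actionUnitIso_hom_naturality]
  simp only [Category.assoc]

/-- The mate used for the inverse of `leftStr`. -/
def leftStrAux : D ⊗ R.obj (F.leftAct X) ⟶ R.obj F :=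
  mate adj (fun m => (αₗ _ _ m).hom ≫ D ⊴ₗ counitL adj X F m ≫
    (αₗ D X (F.obj.obj m)).inv ≫ (ε_ X D) ⊵ₗ (F.obj.obj m) ≫ (λₗ _).hom)
    (leftStrAux_aux adj X D F)

lemma leftStrAux_app (m : M) : leftStrAux adj X D F ⊵ₗ m ≫ counitApp adj F m =
    (αₗ _ _ m).hom ≫ D ⊴ₗ counitL adj X F m ≫
      (αₗ D X (F.obj.obj m)).inv ≫ (ε_ X D) ⊵ₗ (F.obj.obj m) ≫ (λₗ _).hom :=
  mate_app adj _ (leftStrAux_aux adj X D F) m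

/-- The inverse of `leftStr`, for a dual `D` of `X`. -/
def leftStrInv : R.obj (F.leftAct X) ⟶ X ⊗ R.obj F :=
  (λ_ _).inv ≫ (η_ X D) ▷ _ ≫ (α_ _ _ _).hom ≫ X ◁ leftStrAux adj X D F

lemma leftStrInv_comp : leftStrInv adj X D F ≫ leftStr adj X F = 𝟙 _ := by
  apply mate_ext adj
  intro m
  change _ ≫ counitL adj X F m = _ ≫ counitL adj X F m
  rw [comp_actionHomLeft_assoc, leftStr_app, leftStrInv]
  simp only [comp_actionHomLeft, whiskerLeft_actionHomLeft, whiskerRight_actionHomLeft,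
    associator_act, leftUnitor_inv_act, leftStrAux_app, Category.assoc, Iso.inv_hom_id_assoc,
    ← actionHomRight_comp, id_actionHomLeft, Category.id_comp]
  rw [actionHomRight_comp, reassoc_of% assoc_hom_naturality,
    ← action_exchange_assoc, actionUnitIso_inv_naturality_assoc, zigzag₁, Category.comp_id]

lemma leftStr_comp : leftStr adj X F ≫ leftStrInv adj X D F = 𝟙 _ := by
  have e : D ◁ leftStr adj X F ≫ leftStrAux adj X D F =
      (α_ _ _ _).inv ≫ (ε_ X D) ▷ _ ≫ (λ_ _).hom := by
    apply mate_ext adj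
    intro m
    rw [comp_actionHomLeft_assoc, leftStrAux_app]
    simp only [comp_actionHomLeft, whiskerLeft_actionHomLeft, whiskerRight_actionHomLeft,
      associator_inv_act, leftUnitor_actionHom, Category.assoc, Iso.inv_hom_id_assoc]
    rw [← actionHomRight_comp_assoc, leftStr_app, actionHomRight_comp_assoc,
      reassoc_of% assoc_inv_naturality, action_exchange_assoc, actionUnitIso_hom_naturality]
  rw [leftStrInv, leftUnitor_inv_naturality_assoc, whisker_exchange_assoc,
    associator_naturality_right_assoc, ← MonoidalCategory.whiskerLeft_comp, e]
  calc
    _ = 𝟙 _ ⊗≫ ((η_ X D) ▷ X ⊗≫ X ◁ (ε_ X D)) ▷ R.obj F ⊗≫ 𝟙 _ := by monoidal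
    _ = _ := by rw [ExactPairing.evaluation_coevaluation'']; monoidal

end

section
variable (F : Rex k M) (E X : C) [ExactPairing E X]

lemma rightStrAux_aux {m m' : M} (f : m ⟶ m') :
    (R.obj (F.rightAct X) ⊗ E) ⊴ₗ f ≫ (αₗ _ _ m').hom ≫ counitR adj F X (E ⊙ₗ m') ≫
      F.obj.map ((αₗ X E m').inv ≫ (ε_ E X) ⊵ₗ m' ≫ (λₗ _).hom) =
    ((αₗ _ _ m).hom ≫ counitR adj F X (E ⊙ₗ m) ≫
      F.obj.map ((αₗ X E m).inv ≫ (ε_ E X) ⊵ₗ m ≫ (λₗ _).hom)) ≫ F.obj.map f := by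
  have e := action_exchange (ε_ E X) f
  rw [← reassoc_of% assoc_hom_naturality, reassoc_of% counitR_naturality, ← Functor.map_comp,
    reassoc_of% assoc_inv_naturality, reassoc_of% e, ← actionUnitIso_hom_naturality]
  simp only [Category.assoc, Functor.map_comp]

/-- The mate used for the inverse of `rightStr`. -/
def rightStrAux : R.obj (F.rightAct X) ⊗ E ⟶ R.obj F :=
  mate adj (fun m => (αₗ _ _ m).hom ≫ counitR adj F X (E ⊙ₗ m) ≫
    F.obj.map ((αₗ X E m).inv ≫ (ε_ E X) ⊵ₗ m ≫ (λₗ _).hom)) (rightStrAux_aux adj F E X)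

lemma rightStrAux_app (m : M) : rightStrAux adj F E X ⊵ₗ m ≫ counitApp adj F m =
    (αₗ _ _ m).hom ≫ counitR adj F X (E ⊙ₗ m) ≫
      F.obj.map ((αₗ X E m).inv ≫ (ε_ E X) ⊵ₗ m ≫ (λₗ _).hom) :=
  mate_app adj _ (rightStrAux_aux adj F E X) m

/-- The inverse of `rightStr`, for a dual `E` of `X`. -/
def rightStrInv : R.obj (F.rightAct X) ⟶ R.obj F ⊗ X :=
  (ρ_ _).inv ≫ _ ◁ (η_ E X) ≫ (α_ _ _ _).inv ≫ rightStrAux adj F E X ▷ X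

lemma rightStrInv_comp : rightStrInv adj F E X ≫ rightStr adj F X = 𝟙 _ := by
  apply mate_ext adj
  intro m
  change _ ≫ counitR adj F X m = _ ≫ counitR adj F X m
  rw [comp_actionHomLeft_assoc, rightStr_app, rightStrInv]
  simp only [comp_actionHomLeft, whiskerLeft_actionHomLeft, whiskerRight_actionHomLeft,
    associator_inv_act, rightUnitor_inv_act, rightStrAux_app, Category.assoc,
    Iso.inv_hom_id_assoc, id_actionHomLeft, Category.id_comp]
  rw [← actionHomRight_comp_assoc, ← actionHomRight_comp_assoc,
    reassoc_of% counitR_naturality, ← Functor.map_comp, Category.assoc, zigzag₂,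
    CategoryTheory.Functor.map_id, Category.comp_id]

lemma rightStr_comp : rightStr adj F X ≫ rightStrInv adj F E X = 𝟙 _ := by
  have e : rightStr adj F X ▷ E ≫ rightStrAux adj F E X =
      (α_ _ _ _).hom ≫ _ ◁ (ε_ E X) ≫ (ρ_ _).hom := by
    apply mate_ext adj
    intro m
    rw [comp_actionHomLeft_assoc, rightStrAux_app]
    simp only [comp_actionHomLeft, whiskerLeft_actionHomLeft, whiskerRight_actionHomLeft,
      associator_act, rightUnitor_actionHom, Category.assoc, Iso.inv_hom_id_assoc]
    rw [reassoc_of% rightStr_app, ← counitApp_naturality]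
    simp only [actionHomRight_comp, Category.assoc]
  rw [rightStrInv, rightUnitor_inv_naturality_assoc, ← whisker_exchange_assoc,
    associator_inv_naturality_left_assoc, ← comp_whiskerRight, e]
  calc
    _ = 𝟙 _ ⊗≫ R.obj F ◁ (X ◁ (η_ E X) ⊗≫ (ε_ E X) ▷ X) ⊗≫ 𝟙 _ := by monoidal
    _ = _ := by rw [ExactPairing.coevaluation_evaluation'']; monoidal

end

variable [RigidCategory C]

/-- `leftStr` as an isomorphism. -/
@[simps]
def leftIso (X : C) (F : Rex k M) : X ⊗ R.obj F ≅ R.obj (F.leftAct X) where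
  hom := leftStr adj X F
  inv := leftStrInv adj X Xᘁ F
  hom_inv_id := leftStr_comp adj X Xᘁ F
  inv_hom_id := leftStrInv_comp adj X Xᘁ F

/-- `rightStr` as an isomorphism. -/
@[simps]
def rightIso (F : Rex k M) (X : C) : R.obj F ⊗ X ≅ R.obj (F.rightAct X) where
  hom := rightStr adj F X
  inv := rightStrInv adj F (ᘁX) X
  hom_inv_id := rightStr_comp adj F (ᘁX) X
  inv_hom_id := rightStrInv_comp adj F (ᘁX) X

/-- The module structure of `F` as an isomorphism `X ⊗ F ≅ F ⊗ X` of endofunctors. -/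
def strIso (F : RexMod k C M) (X : C) : F.toRex.leftAct X ≅ F.toRex.rightAct X :=
  ObjectProperty.isoMk _ (NatIso.ofComponents (fun m => Functor.LeftLinear.μₗIso F.toRex.obj X m)
    (fun f => μₗ_naturality_right F.toRex.obj X f))

/-- The composite `R(F) ⊗ X ≅ R(F ⊗ X) ≅ R(X ⊗ F) ≅ X ⊗ R(F)` of `rightStr`, the image under `R` of
the inverse of the module structure of `F`, and the inverse of `leftStr`. -/
def halfBraidingIso (F : RexMod k C M) (X : C) : R.obj F.toRex ⊗ X ≅ X ⊗ R.obj F.toRex :=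
  rightIso adj F.toRex X ≪≫ R.mapIso (strIso F X).symm ≪≫ (leftIso adj X F.toRex).symm

lemma halfBraidingIso_app (F : RexMod k C M) (X : C) (m : M) :
    (halfBraidingIso adj F X).hom ⊵ₗ m ≫ (αₗ _ _ m).hom ≫ X ⊴ₗ counitApp adj F.toRex m =
      (αₗ _ _ m).hom ≫ counitApp adj F.toRex (X ⊙ₗ m) ≫ δₗ F.toRex.obj X m := by
  rw [← leftStr_app, ← comp_actionHomLeft_assoc, ← leftIso_hom]
  simp only [halfBraidingIso, Iso.trans_hom, Iso.symm_hom, Category.assoc, Iso.inv_hom_id,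
    Category.comp_id, comp_actionHomLeft]
  have e : _ = counitR adj F.toRex X m ≫ δₗ F.toRex.obj X m := map_counitApp adj (strIso F X).inv m
  change (rightStr adj F.toRex X) ⊵ₗ m ≫ R.map (strIso F X).inv ⊵ₗ m ≫
    counitApp adj (F.toRex.leftAct X) m = _
  rw [e]
  exact (reassoc_of% (rightStr_app adj F.toRex X m)) _

lemma tensor_mate_ext {W X : C} {F : Rex k M} {a b : W ⟶ X ⊗ R.obj F}
    (h : ∀ m : M, a ⊵ₗ m ≫ (αₗ _ _ m).hom ≫ X ⊴ₗ counitApp adj F m =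
      b ⊵ₗ m ≫ (αₗ _ _ m).hom ≫ X ⊴ₗ counitApp adj F m) : a = b := by
  rw [← cancel_mono (leftIso adj X F).hom]
  apply mate_ext adj
  intro m
  change _ ≫ counitL adj X F m = _ ≫ counitL adj X F m
  rw [comp_actionHomLeft_assoc, comp_actionHomLeft_assoc, leftIso_hom, leftStr_app, h]

/-- The isomorphisms `halfBraidingIso` form a half-braiding of `R(F)`. -/
def radjHalfBraiding (F : RexMod k C M) : HalfBraiding (R.obj F.toRex) where
  β := halfBraidingIso adj F
  monoidal X Y := by
    apply tensor_mate_ext adj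
    intro m
    rw [halfBraidingIso_app]
    simp only [comp_actionHomLeft, whiskerLeft_actionHomLeft, whiskerRight_actionHomLeft,
      associator_act, associator_inv_act, tensor_actionHomRight, Category.assoc,
      Iso.inv_hom_id_assoc]
    rw [← actionHomRight_comp_assoc X, ← actionHomRight_comp_assoc X, Category.assoc,
      ← actionHomRight_comp_assoc X, Category.assoc, Category.assoc, halfBraidingIso_app]
    simp only [actionHomRight_comp, Category.assoc, actionHomRight_inv_hom_assoc]
    rw [reassoc_of% halfBraidingIso_app]
    simp only [Iso.inv_hom_id_assoc]
    rw [reassoc_of% (counitApp_naturality adj F.toRex), ← reassoc_of% (δₗ_associativity F.toRex.obj)]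
    simp only [Iso.hom_inv_id, Category.comp_id]
  naturality {X Y} f := by
    apply tensor_mate_ext adj
    intro m
    rw [comp_actionHomLeft_assoc, halfBraidingIso_app, comp_actionHomLeft_assoc,
      whiskerLeft_actionHomLeft, whiskerRight_actionHomLeft]
    simp only [Category.assoc, Iso.inv_hom_id_assoc]
    rw [← action_exchange, reassoc_of% halfBraidingIso_app,
      reassoc_of% (counitApp_naturality adj F.toRex), δₗ_naturality_left]

/-- The lift of a right adjoint `R` of the action functor to a functor from right exact module
functors to the Drinfeld center: `F` goes to `R(F)` with the half-braiding above. -/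
def radjCenter : RexMod k C M ⥤ Center C where
  obj F := ⟨R.obj F.toRex, radjHalfBraiding adj F⟩
  map {F G} φ :=
    { f := R.map φ.nat
      comm X := by
        apply tensor_mate_ext adj
        intro m
        change (R.map φ.nat ▷ X ≫ (halfBraidingIso adj G X).hom) ⊵ₗ m ≫ _ =
          ((halfBraidingIso adj F X).hom ≫ X ◁ R.map φ.nat) ⊵ₗ m ≫ _
        rw [comp_actionHomLeft_assoc, comp_actionHomLeft_assoc, halfBraidingIso_app,
          whiskerLeft_actionHomLeft, whiskerRight_actionHomLeft]
        simp only [Category.assoc, Iso.inv_hom_id_assoc]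
        have e (m) : R.map φ.nat ⊵ₗ m ≫ counitApp adj G.toRex m =
          counitApp adj F.toRex m ≫ φ.nat.hom.app m := map_counitApp adj φ.nat m
        rw [← actionHomRight_comp, e, actionHomRight_comp, reassoc_of% halfBraidingIso_app,
          reassoc_of% e, φ.comm_δ] }
  map_id F := Center.ext _ _ (R.map_id _)
  map_comp f g := Center.ext _ _ (R.map_comp _ _)

end
end Functors

section Ends
open MonoidalLeftAction
variable {k : Type v} [Field k]
  {C : Type u₁} [Category.{v} C] [MonoidalCategory C] [Preadditive C] [Linear k C]
  {M : Type u₂} [Category.{v} M] [Preadditive M] [Linear k M]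
  [MonoidalLeftAction C M] [IsFiniteLeftModuleCategory k C M]

/-- The bifunctor `(m, m') ↦ Hom(m, F(m'))`, where `H` is an internal Hom functor. -/
abbrev ihomFunctor (H : Mᵒᵖ ⥤ M ⥤ C) (F : M ⥤ M) : Mᵒᵖ ⥤ M ⥤ C :=
  H ⋙ (Functor.whiskeringLeft M M C).obj F

/-- The wedge `R(F) ⟶ Hom(m, F(m))` whose components correspond to the components
`R(F) ⊗ m ⟶ F(m)` of the counit. -/
def counitWedge {R : Rex k M ⥤ C} (adj : act k C M ⊣ R) {H : Mᵒᵖ ⥤ M ⥤ C}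
    (hadj : (curriedAction C M).flip ⊣₂ H) (F : Rex k M) : Wedge (ihomFunctor H F.obj) :=
  Wedge.mk (R.obj F) (fun m => hadj.homEquiv (counitApp adj F m)) (fun m m' f => by
    have e₁ := hadj.homEquiv_naturality_three (X₁ := m) (X₂ := R.obj F) (F.obj.map f)
      (counitApp adj F m)
    have e₂ := hadj.homEquiv_naturality_one (X₂ := R.obj F) f (counitApp adj F m')
    refine e₁.symm.trans (Eq.trans ?_ e₂)
    exact congrArg hadj.homEquiv (counitApp_naturality adj F f).symm)

end Ends
end FinTensor

/-! Existence of the adjoints. Let `Q` be a projective separator of the source. A pair `(X, x : L X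
⟶ F)` is reduced if `x` kills no nonzero `Q ⟶ X`; since `L` respects cokernels, every pair descends
to a reduced one on a quotient. If the dimension of `Hom(Q, X)` is bounded over reduced pairs, a
reduced pair of maximal dimension is terminal over `F`, and `L` has a right adjoint
(`isLeftAdjoint_of_bounded`). This applies to `- ⊗ m`, giving the internal Hom, and to `act`, where
naturality and duality reduce a transformation to its component at a projective separator of `M`.

Claims 1 to 3 are formal. A morphism into `R(F)` is determined by its composites with the counit,
and in these terms the half-braiding of `R(F)` is the module structure of `F`. So the unit and
counit respect the extra structure, and the triangle identities are inherited (`centerAdjunction`).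
A wedge over `Hom(m, F(m))` with vertex `W` is by transposition a natural family `W ⊗ m ⟶ F(m)`,
that is, a morphism `W ⟶ R(F)`.

The substance of claim 4 is that `schauenburg` is an equivalence. Let `p` be a nonzero projective of
`M` and `B = Hom(p, p)`. As `p` is projective, `Hom(p, -)` is right exact, so the functors `Hom(p,
-) ⊗ n` lie in the dual category and serve as test objects. As the unit is simple, the action is
faithful on morphisms and the evaluation `ε : B ⊗ B' ⟶ 𝟙` of a dual `B'` of `B` is epi.

Morphisms: if `ψ : X ⊗ - ⟶ Y ⊗ -` commutes with the dual category, testing on `Hom(p, -) ⊗ n` at `p`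
shows that `ψ` at `B ⊗ n` is the action of a morphism `X ⊗ B ⟶ Y ⊗ B`. Descent along `ε` yields a
morphism `X ⟶ Y` (`IsCentral.exists_eq`).

Objects: the half-braiding of a central `F` gives `Hom(p, F(p)) ⊗ n ≅ F(B ⊗ n)`. With `K = ker ε`,
right exactness presents `F(n)` as the cokernel of `F(K ⊗ n) ⟶ F(B ⊗ B' ⊗ n)`. The target is the
action of `S = Hom(p, F(p)) ⊗ B'`, and the relations are covered by a central transformation from `S
⊗ K`, hence by a morphism `j : S ⊗ K ⟶ S`. Thus `F ≅ coker j ⊗ -` (`exists_actionLeft_iso`), and the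
module structure of `F` becomes a half-braiding of `coker j`.

The rest of claim 4 is uniqueness of right adjoints. -/

namespace FinTensor

/-! ### Finite abelian categories: abelian structure, finite-dimensional Homs, a projective
separator. -/

section FiniteAbelian
variable (k : Type v) [Field k] {A : Type u} [Category.{v} A] [Preadditive A] [Linear k A]

/-- The abelian structure of a finite abelian category, on its given preadditive structure. -/
@[reducible]
noncomputable def IsFiniteAbelian.abelian (h : IsFiniteAbelian k A) : Abelian A :=
  have : Nonempty { a : Abelian A // a.toPreadditive = ‹Preadditive A› } := by
    obtain ⟨R, _, _, _, e, _, _⟩ := h.exists_equivalence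
    have : IsNoetherianRing R := IsNoetherianRing.of_finite k R
    have : HasFiniteProducts A :=
      ⟨fun n => Adjunction.hasLimitsOfShape_of_equivalence e.functor⟩
    exact ⟨⟨abelianOfEquivalence e.functor, rfl⟩⟩
  -- The existential only yields some abelian structure by choice; taking the fields one at a time
  -- keeps the given preadditive structure definitionally.
  { toPreadditive := ‹Preadditive A›
    normalMonoOfMono := by
      obtain ⟨a, rfl⟩ := this.some
      exact a.normalMonoOfMono
    normalEpiOfEpi := by
      obtain ⟨a, rfl⟩ := this.some
      exact a.normalEpiOfEpi
    has_finite_products := this.some.1.has_finite_products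
    has_kernels := by
      obtain ⟨a, rfl⟩ := this.some
      exact a.has_kernels
    has_cokernels := by
      obtain ⟨a, rfl⟩ := this.some
      exact a.has_cokernels }

/-- Forgetting `R`-linearity embeds the Hom space into the `k`-linear maps between two
finite-dimensional spaces. -/
lemma IsFiniteAbelian.finite_hom (h : IsFiniteAbelian k A) (X Y : A) : Module.Finite k (X ⟶ Y) := by
  obtain ⟨R, _, _, _, e, _, _⟩ := h.exists_equivalence
  let V := e.functor.obj X
  let W := e.functor.obj Y
  let _ : Module k V := Module.compHom V (algebraMap k R)
  let _ : Module k W := Module.compHom W (algebraMap k R)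
  have : IsScalarTower k R V := ⟨fun a r x => by
    rw [Algebra.smul_def, mul_smul]; rfl⟩
  have : IsScalarTower k R W := ⟨fun a r x => by
    rw [Algebra.smul_def, mul_smul]; rfl⟩
  have : Module.Finite k V := Module.Finite.trans R V
  have : Module.Finite k W := Module.Finite.trans R W
  let φ : (X ⟶ Y) →ₗ[k] (V →ₗ[k] W) :=
    { toFun := fun f => (e.functor.map f).hom.hom.restrictScalars k
      map_add' := fun f g => by
        rw [Functor.map_add]; rfl
      map_smul' := fun c f => by
        rw [Functor.map_smul]; ext x; rfl }
  refine Module.Finite.of_injective φ (fun f g hfg => ?_)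
  apply e.functor.map_injective
  ext x
  exact LinearMap.congr_fun hfg x

/-- The regular module works: a map out of `R` is an element of the target, so such maps lift along
surjections and separate morphisms. -/
lemma IsFiniteAbelian.exists_projective_separator (h : IsFiniteAbelian k A) :
    ∃ Q : A, Projective Q ∧ IsSeparator Q := by
  obtain ⟨R, _, _, _, e, _, _⟩ := h.exists_equivalence
  have : IsNoetherianRing R := IsNoetherianRing.of_finite k R
  let Q₀ : FGModuleCat.{v} R := FGModuleCat.of R R
  have hQ : Projective Q₀ := ⟨fun {X Y} f p _ => by
    have hp : Epi ((forget₂ (FGModuleCat R) (ModuleCat.{v} R)).map p) := inferInstance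
    rw [ModuleCat.epi_iff_surjective] at hp
    obtain ⟨y, hy⟩ := hp (f.hom.hom (1 : R))
    refine ⟨FGModuleCat.ofHom (LinearMap.toSpanSingleton R X y), ?_⟩
    ext
    change p.hom.hom ((1 : R) • y) = f.hom.hom (1 : R)
    rw [one_smul]
    exact hy⟩
  refine ⟨e.inverse.obj Q₀, ?_, ?_⟩
  · exact e.symm.toAdjunction.map_projective _ hQ
  · rw [isSeparator_def]
    intro X Y f g hfg
    apply e.functor.map_injective
    ext x
    let y : Q₀ ⟶ e.functor.obj X := FGModuleCat.ofHom (LinearMap.toSpanSingleton R _ x)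
    let adj := e.symm.toAdjunction
    have h₁ := congrArg (adj.homEquiv Q₀ Y)
      (hfg ((adj.homEquiv Q₀ X).symm y))
    rw [adj.homEquiv_naturality_right, adj.homEquiv_naturality_right, Equiv.apply_symm_apply] at h₁
    have h₂ := congrArg (fun t : Q₀ ⟶ e.functor.obj Y => t.hom.hom (1 : R)) h₁
    change (e.functor.map f).hom.hom ((1 : R) • x) = (e.functor.map g).hom.hom ((1 : R) • x) at h₂
    rwa [one_smul] at h₂

end FiniteAbelian

/-! ### A criterion for the existence of right adjoints. -/

section Representability

lemma eq_zero_of_separator {A : Type u} [Category.{v} A] [Preadditive A] {Q X Y : A}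
    (hs : IsSeparator Q) (g : X ⟶ Y) (h : ∀ f : Q ⟶ X, f ≫ g = 0) : g = 0 :=
  (Preadditive.isSeparator_iff Q).1 hs g h

variable (k : Type v) [Field k] {A : Type u} [Category.{v} A] [Abelian A] [Linear k A]
  [∀ X Y : A, Module.Finite k (X ⟶ Y)] {Q : A} [Projective Q] (hs : IsSeparator Q)
  {E : Type*} [Category* E] [Preadditive E] {L : A ⥤ E} [L.Additive] {F : E}

/-- No nonzero morphism `Q ⟶ X` is killed by `x : L X ⟶ F`. -/
def IsReduced (Q : A) {X : A} (x : L.obj X ⟶ F) : Prop :=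
  ∀ f : Q ⟶ X, L.map f ≫ x = 0 → f = 0

-- Induction on the dimension of `Hom(Q, X)`: a nonzero `f : Q ⟶ X` killed by `x` lets `x` descend
-- to the cokernel of `f`, where this dimension is smaller.
include k in
omit [L.Additive] in
lemma exists_reduced
    (hdesc : ∀ {X Y : A} (f : X ⟶ Y) (x : L.obj Y ⟶ F), L.map f ≫ x = 0 →
      ∃ x', L.map (cokernel.π f) ≫ x' = x) {X : A} (x : L.obj X ⟶ F) :
    ∃ (Y : A) (r : X ⟶ Y) (y : L.obj Y ⟶ F), L.map r ≫ y = x ∧ IsReduced Q y := by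
  induction hn : Module.finrank k (Q ⟶ X) using Nat.strong_induction_on generalizing X with
  | _ n ih =>
    by_cases hx : IsReduced Q x
    · exact ⟨X, 𝟙 X, x, by simp, hx⟩
    · simp only [IsReduced, not_forall] at hx
      obtain ⟨f, hf, hf0⟩ := hx
      obtain ⟨x', hx'⟩ := hdesc f x hf
      -- Projectivity of `Q` makes this surjective, and `f` is a nonzero element of its kernel, so
      -- the dimension drops.
      have hsurj : Function.Surjective (Linear.rightComp k Q (cokernel.π f)) := fun g =>
        ⟨Projective.factorThru g _, Projective.factorThru_comp g _⟩
      have hlt : Module.finrank k (Q ⟶ cokernel f) < n := by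
        rw [← hn, ← LinearMap.finrank_range_add_finrank_ker (Linear.rightComp k Q (cokernel.π f)),
          LinearMap.range_eq_top.2 hsurj, finrank_top]
        have : 0 < Module.finrank k (LinearMap.ker (Linear.rightComp k Q (cokernel.π f))) := by
          rw [Module.finrank_pos_iff_exists_ne_zero]
          refine ⟨⟨f, ?_⟩, fun h => hf0 (congrArg Subtype.val h)⟩
          simp
        omega
      obtain ⟨Y, r, y, hy, hr⟩ := ih _ hlt x' rfl
      exact ⟨Y, cokernel.π f ≫ r, y, by rw [L.map_comp, Category.assoc, hy, hx'], hr⟩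

include k hs in
/-- An additive functor from a finite abelian category that is compatible with cokernels is a left
adjoint if the elements of `Hom(L X, F)` that are not supported on a quotient of `X` exist only for
`X` of bounded size. -/
lemma isLeftAdjoint_of_bounded
    (hdesc : ∀ {X Y : A} {F : E} (f : X ⟶ Y) (x : L.obj Y ⟶ F), L.map f ≫ x = 0 →
      ∃ x', L.map (cokernel.π f) ≫ x' = x)
    (hbound : ∀ F : E, ∃ N, ∀ (X : A) (x : L.obj X ⟶ F), IsReduced Q x →
      Module.finrank k (Q ⟶ X) ≤ N) : L.IsLeftAdjoint := by
  suffices ∀ F, HasTerminal (CostructuredArrow L F) from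
    isLeftAdjoint_of_costructuredArrowTerminals L
  intro F
  obtain ⟨N, hN⟩ := hbound F
  let S : Set ℕ := {n | ∃ (X : A) (x : L.obj X ⟶ F), IsReduced Q x ∧
    n = Module.finrank k (Q ⟶ X)}
  have hS : S.Nonempty := by
    obtain ⟨Y, r, y, -, hr⟩ := exists_reduced k (Q := Q) (F := F) hdesc (X := Q) 0
    exact ⟨_, Y, y, hr, rfl⟩
  have hSb : BddAbove S := ⟨N, by
    rintro n ⟨X, x, hx, rfl⟩
    exact hN X x hx⟩
  -- The terminal object over `F` is a reduced pair with `Hom(Q, X)` of maximal dimension.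
  obtain ⟨X, x, hx, hmax⟩ := Nat.sSup_mem hS hSb
  have hex {Y : A} (y : L.obj Y ⟶ F) : ∃ g : Y ⟶ X, L.map g ≫ x = y := by
    -- Amalgamate both pairs on `X ⊞ Y` and reduce. The leg `i : X ⟶ Z` is mono since `x` is
    -- reduced, and by maximality it is an isomorphism, so the other leg gives `Y ⟶ X`.
    obtain ⟨Z, r, z, hz, hr⟩ := exists_reduced k (Q := Q) (F := F) hdesc (X := X ⊞ Y)
      (L.map biprod.fst ≫ x + L.map biprod.snd ≫ y)
    have e₁ : L.map (biprod.inl ≫ r) ≫ z = x := by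
      rw [L.map_comp, Category.assoc, hz, Preadditive.comp_add, ← L.map_comp_assoc,
        ← L.map_comp_assoc]
      simp
    have e₂ : L.map (biprod.inr ≫ r) ≫ z = y := by
      rw [L.map_comp, Category.assoc, hz, Preadditive.comp_add, ← L.map_comp_assoc,
        ← L.map_comp_assoc]
      simp
    let i : X ⟶ Z := biprod.inl ≫ r
    have hinj : Function.Injective (Linear.rightComp k Q i) := by
      rw [injective_iff_map_eq_zero]
      intro f hf
      apply hx
      rw [← e₁, ← L.map_comp_assoc, show f ≫ biprod.inl ≫ r = 0 from hf, L.map_zero, zero_comp]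
    have hle : Module.finrank k (Q ⟶ Z) ≤ Module.finrank k (Q ⟶ X) := by
      rw [← hmax]
      exact le_csSup hSb ⟨Z, z, hr, rfl⟩
    have hsurj : Function.Surjective (Linear.rightComp k Q i) :=
      (LinearMap.injective_iff_surjective_of_finrank_eq_finrank
        (le_antisymm (LinearMap.finrank_le_finrank_of_injective hinj) hle)).1 hinj
    have : Mono i := Preadditive.mono_of_cancel_zero _ fun g hg =>
      eq_zero_of_separator hs g fun h => hinj (by
        change (h ≫ g) ≫ i = 0 ≫ i
        rw [Category.assoc, hg, comp_zero, zero_comp])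
    have : Epi i := Preadditive.epi_of_cancel_zero _ fun g hg =>
      eq_zero_of_separator hs g fun h => by
        obtain ⟨h', rfl⟩ := hsurj h
        change (h' ≫ i) ≫ g = 0
        rw [Category.assoc, hg, comp_zero]
    have : IsIso i := isIso_of_mono_of_epi i
    refine ⟨biprod.inr ≫ r ≫ inv i, ?_⟩
    have e₃ : L.map (inv i) ≫ x = z := by
      rw [← e₁, ← L.map_comp_assoc, IsIso.inv_hom_id, L.map_id, Category.id_comp]
    rw [← e₂, L.map_comp, L.map_comp, L.map_comp, Category.assoc, Category.assoc, Category.assoc,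
      e₃]
  -- Composites of maps `Q ⟶ Y` with the difference of two solutions are killed by the reduced `x`.
  have huniq {Y : A} (g g' : Y ⟶ X) (h : L.map g ≫ x = L.map g' ≫ x) : g = g' := by
    rw [← sub_eq_zero]
    refine eq_zero_of_separator hs _ fun f => hx _ ?_
    rw [L.map_comp, Category.assoc, L.map_sub, Preadditive.sub_comp, h, sub_self, comp_zero]
  have (B : CostructuredArrow L F) : Nonempty (B ⟶ CostructuredArrow.mk x) := by
    obtain ⟨g, hg⟩ := hex B.hom
    exact ⟨CostructuredArrow.homMk g hg⟩
  have (B : CostructuredArrow L F) : Subsingleton (B ⟶ CostructuredArrow.mk x) := ⟨fun f g => by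
    ext
    exact huniq _ _ ((CostructuredArrow.w f).trans (CostructuredArrow.w g).symm)⟩
  exact hasTerminal_of_unique (CostructuredArrow.mk x)

end Representability

end FinTensor

/-! ### Existence of the internal Hom and of the right adjoint of the action functor. -/

namespace FinTensor
open MonoidalLeftAction

lemma exists_desc_of_preservesFiniteColimits {A : Type*} [Category* A] [Preadditive A]
    {B : Type*} [Category* B] [Preadditive B] (G : A ⥤ B) [G.Additive] [PreservesFiniteColimits G]
    {X Y Z : A} {f : X ⟶ Y} {p : Y ⟶ Z} {w : f ≫ p = 0} (hp : IsColimit (CokernelCofork.ofπ p w))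
    {W : B} (x : G.obj Y ⟶ W) (hx : G.map f ≫ x = 0) : ∃ x', G.map p ≫ x' = x := by
  obtain ⟨l, hl⟩ := CokernelCofork.IsColimit.desc' (CokernelCofork.mapIsColimit _ hp G) x hx
  exact ⟨l, hl⟩

/-- Chosen right adjoints become functorial in the parameter by taking conjugates of the natural
transformations `F.map f`. -/
lemma exists_parametrizedAdjunction {C₁ C₂ C₃ : Type*} [Category* C₁] [Category* C₂] [Category* C₃]
    (F : C₁ ⥤ C₂ ⥤ C₃) (h : ∀ X, (F.obj X).IsLeftAdjoint) :
    ∃ G : C₁ᵒᵖ ⥤ C₃ ⥤ C₂, Nonempty (F ⊣₂ G) := by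
  let a (X : C₁) := Adjunction.ofIsLeftAdjoint (F.obj X)
  let G : C₁ᵒᵖ ⥤ C₃ ⥤ C₂ :=
    { obj X := (F.obj X.unop).rightAdjoint
      map {X Y} f := conjugateEquiv (a X.unop) (a Y.unop) (F.map f.unop)
      map_id X := by
        rw [unop_id, F.map_id]
        exact conjugateEquiv_id _
      map_comp f g := by
        rw [unop_comp, F.map_comp, conjugateEquiv_comp] }
  exact ⟨G, ⟨{ adj := a
               unit_whiskerRight_map {X Y} f := by
                ext m
                exact (unit_conjugateEquiv (a Y) (a X) (F.map f) m).symm }⟩⟩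

section Adjunctions
variable {C : Type u₁} [Category.{v} C] [MonoidalCategory C]
  {M : Type u₂} [Category.{v} M] [MonoidalLeftAction C M]

lemma coevAct_naturality (X D : C) [ExactPairing X D] {m m' : M} (f : m ⟶ m') :
    f ≫ (λₗ m').inv ≫ (η_ X D) ⊵ₗ m' ≫ (αₗ X D m').hom =
      ((λₗ m).inv ≫ (η_ X D) ⊵ₗ m ≫ (αₗ X D m).hom) ≫ X ⊴ₗ D ⊴ₗ f := by
  have e := action_exchange (η_ X D) f
  simp only [Category.assoc, assoc_hom_naturality, actionUnitIso_inv_naturality_assoc,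
    ← reassoc_of% e]

lemma evAct_naturality (X D : C) [ExactPairing X D] {m m' : M} (f : m ⟶ m') :
    D ⊴ₗ X ⊴ₗ f ≫ (αₗ D X m').inv ≫ (ε_ X D) ⊵ₗ m' ≫ (λₗ m').hom =
      ((αₗ D X m).inv ≫ (ε_ X D) ⊵ₗ m ≫ (λₗ m).hom) ≫ f := by
  have e := action_exchange (ε_ X D) f
  rw [reassoc_of% assoc_inv_naturality, reassoc_of% e, ← actionUnitIso_hom_naturality]
  simp only [Category.assoc]

/-- The action of a dual is adjoint to the action. -/
def actionLeftAdjunction (X D : C) [ExactPairing X D] : actionLeft M D ⊣ actionLeft M X where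
  unit :=
    { app m := (λₗ m).inv ≫ (η_ X D) ⊵ₗ m ≫ (αₗ X D m).hom
      naturality _ _ f := coevAct_naturality X D f }
  counit :=
    { app m := (αₗ D X m).inv ≫ (ε_ X D) ⊵ₗ m ≫ (λₗ m).hom
      naturality _ _ f := evAct_naturality X D f }
  left_triangle_components m := zigzag₂ X D m
  right_triangle_components m := by
    have h := zigzag₁ X D m
    rw [← Category.assoc, ← Category.assoc, Category.assoc ((λₗ (X ⊙ₗ m)).inv)] at h
    exact h

end Adjunctions

section Existence
variable (k : Type v) [Field k]
  (C : Type u₁) [Category.{v} C] [MonoidalCategory C] [Preadditive C] [Linear k C]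
  (M : Type u₂) [Category.{v} M] [Preadditive M] [Linear k M] [MonoidalLeftAction C M]
  [IsFiniteLeftModuleCategory k C M]

-- For reduced `x : X ⊗ m ⟶ n` the map `f ↦ (f ⊗ m) ≫ x` embeds `Hom(Q, X)` into `Hom(Q ⊗ m, n)`,
-- which gives the bound.
variable {C M} in
lemma isLeftAdjoint_actionRight [IsFiniteAbelian k C] (m : M) :
    (actionRight C m).IsLeftAdjoint := by
  have hC : IsFiniteAbelian k C := inferInstance
  have hM : IsFiniteAbelian k M := IsFiniteLeftModuleCategory.finiteAbelian C
  let _ := hC.abelian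
  have := hC.finite_hom
  have := hM.finite_hom
  obtain ⟨Q, _, hs⟩ := hC.exists_projective_separator
  have : (actionRight C m).Additive := IsFiniteLeftModuleCategory.additive_actionRight k m
  have : (actionRight C m).Linear k := IsFiniteLeftModuleCategory.linear_actionRight m
  have : PreservesFiniteColimits (actionRight C m) :=
    IsFiniteLeftModuleCategory.rightExact_actionRight k m
  refine isLeftAdjoint_of_bounded k hs (fun f x hx =>
    exists_desc_of_preservesFiniteColimits _ (w := cokernel.condition f) (cokernelIsCokernel f) x hx)
    (fun n => ⟨Module.finrank k (Q ⊙ₗ m ⟶ n), fun X x hx => ?_⟩)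
  let φ : (Q ⟶ X) →ₗ[k] (Q ⊙ₗ m ⟶ n) :=
    (Linear.rightComp k (Q ⊙ₗ m) x).comp ((actionRight C m).mapLinearMap k)
  refine LinearMap.finrank_le_finrank_of_injective (f := φ) ?_
  rw [injective_iff_map_eq_zero]
  exact hx

instance additive_act : (act k C M).Additive where
  map_add {X Y f g} := by
    ext m
    exact (IsFiniteLeftModuleCategory.additive_actionRight k m).map_add

-- The functor `X ⊗ -` is left adjoint to the action of `ᘁX`, so the vanishing can be tested on the
-- transpose `m ⟶ ᘁX ⊗ n`.
include k in
variable {C M} in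
lemma actionLeft_eq_zero_of_separator [RigidCategory C] {P : M} (hP : IsSeparator P) {X : C}
    {m n : M} (z : X ⊙ₗ m ⟶ n) (h : ∀ g : P ⟶ m, X ⊴ₗ g ≫ z = 0) : z = 0 := by
  let adj : actionLeft M X ⊣ actionLeft M (ᘁX) := actionLeftAdjunction (ᘁX) X
  have : (actionLeft M (ᘁX)).Additive := IsFiniteLeftModuleCategory.additive_actionLeft k _
  have h₀ (a b : M) : adj.homEquiv a b 0 = 0 := by
    rw [adj.homEquiv_unit, Functor.map_zero, comp_zero]
  refine (adj.homEquiv m n).injective (Eq.trans ?_ (h₀ m n).symm)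
  exact eq_zero_of_separator hP _ fun g =>
    (adj.homEquiv_naturality_left g z).symm.trans ((congrArg _ (h g)).trans (h₀ P n))

/-- The bound comes from evaluating at a projective separator `P` of `M`: a transformation `Q ⊗ - ⟶
F` whose component at `P` vanishes is zero. -/
lemma isLeftAdjoint_act [IsFiniteAbelian k C] [RigidCategory C] : (act k C M).IsLeftAdjoint := by
  have hC : IsFiniteAbelian k C := inferInstance
  have hM : IsFiniteAbelian k M := IsFiniteLeftModuleCategory.finiteAbelian C
  let _ := hC.abelian
  have := hC.finite_hom
  have := hM.finite_hom
  obtain ⟨Q, _, hs⟩ := hC.exists_projective_separator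
  obtain ⟨P, _, hP⟩ := hM.exists_projective_separator
  have add (m : M) : (actionRight C m).Additive :=
    IsFiniteLeftModuleCategory.additive_actionRight k m
  have lin (m : M) : (actionRight C m).Linear k := IsFiniteLeftModuleCategory.linear_actionRight m
  have rex (m : M) : PreservesFiniteColimits (actionRight C m) :=
    IsFiniteLeftModuleCategory.rightExact_actionRight k m
  refine isLeftAdjoint_of_bounded k hs (fun {X Y F} f x hx => ?_)
    (fun F => ⟨Module.finrank k (Q ⊙ₗ P ⟶ F.obj.obj P), fun X x hx => ?_⟩)
  · let t (m : M) : Y ⊙ₗ m ⟶ F.obj.obj m := x.hom.app m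
    have ht {m m' : M} (g : m ⟶ m') : Y ⊴ₗ g ≫ t m' = t m ≫ F.obj.map g := x.hom.naturality g
    have h (m : M) : ∃ y : cokernel f ⊙ₗ m ⟶ F.obj.obj m, cokernel.π f ⊵ₗ m ≫ y = t m :=
      exists_desc_of_preservesFiniteColimits (actionRight C m) (w := cokernel.condition f)
        (cokernelIsCokernel f) (t m) (congrArg (fun t => t.hom.app m) hx)
    choose y hy using h
    have hepi (m : M) : Epi (cokernel.π f ⊵ₗ m) :=
      inferInstanceAs (Epi ((actionRight C m).map (cokernel.π f)))
    -- The componentwise factorizations are natural because `cokernel.π f` acts by epimorphisms.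
    have hn {m m' : M} (g : m ⟶ m') : cokernel f ⊴ₗ g ≫ y m' = y m ≫ F.obj.map g := by
      rw [← cancel_epi (cokernel.π f ⊵ₗ m), ← action_exchange_assoc, hy, reassoc_of% hy, ht]
    refine ⟨ObjectProperty.homMk { app := y, naturality := fun m m' g => hn g }, ?_⟩
    ext m
    exact hy m
  · let t (m : M) : X ⊙ₗ m ⟶ F.obj.obj m := x.hom.app m
    have ht {m m' : M} (g : m ⟶ m') : X ⊴ₗ g ≫ t m' = t m ≫ F.obj.map g := x.hom.naturality g
    let φ : (Q ⟶ X) →ₗ[k] (Q ⊙ₗ P ⟶ F.obj.obj P) :=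
      (Linear.rightComp k (Q ⊙ₗ P) (t P)).comp ((actionRight C P).mapLinearMap k)
    refine LinearMap.finrank_le_finrank_of_injective (f := φ) ?_
    rw [injective_iff_map_eq_zero]
    intro f hf
    have hf' : f ⊵ₗ P ≫ t P = 0 := hf
    refine hx f ?_
    ext m
    refine actionLeft_eq_zero_of_separator k hP (f ⊵ₗ m ≫ t m) fun g => ?_
    rw [action_exchange_assoc, ht, reassoc_of% hf', zero_comp]

end Existence
end FinTensor

namespace FinTensor
open MonoidalLeftAction Functor.LaxLeftLinear Functor.OplaxLeftLinear

/-! ### The adjunction lifted to the center, and the universal wedge. -/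

section CenterAdjunction
variable {k : Type v} [Field k]
  {C : Type u₁} [Category.{v} C] [MonoidalCategory C] [Preadditive C] [Linear k C]
  {M : Type u₂} [Category.{v} M] [Preadditive M] [Linear k M]
  [MonoidalLeftAction C M] [IsFiniteLeftModuleCategory k C M]
  {R : Rex k M ⥤ C} (adj : act k C M ⊣ R)

variable [RigidCategory C]

/-- This makes the unit a morphism of the center. After composition with the counit, the triangle
identity removes the unit and leaves the given half-braiding on both sides. -/
lemma unit_halfBraiding {V : C} (b : HalfBraiding V) (X : C) :
    (show V ⟶ R.obj (braidedAct k M b).toRex from adj.unit.app V) ▷ X ≫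
        (halfBraidingIso adj (braidedAct k M b) X).hom =
      (b.β X).hom ≫ X ◁ (show V ⟶ R.obj (braidedAct k M b).toRex from adj.unit.app V) := by
  let u : V ⟶ R.obj (braidedAct k M b).toRex := adj.unit.app V
  let c (m : M) : R.obj (braidedAct k M b).toRex ⊙ₗ m ⟶ V ⊙ₗ m :=
    counitApp adj (braidedAct k M b).toRex m
  have h₁ (m : M) : u ⊵ₗ m ≫ c m = 𝟙 (V ⊙ₗ m) :=
    congrArg (fun t => t.hom.app m) (adj.left_triangle_components V)
  have h₂ (m : M) : (halfBraidingIso adj (braidedAct k M b) X).hom ⊵ₗ m ≫ (αₗ _ _ m).hom ≫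
      X ⊴ₗ c m = (αₗ _ _ m).hom ≫ c (X ⊙ₗ m) ≫ (braidAct b X m).hom :=
    halfBraidingIso_app adj (braidedAct k M b) X m
  change u ▷ X ≫ _ = _ ≫ X ◁ u
  apply tensor_mate_ext adj
  intro m
  change _ ≫ _ ≫ X ⊴ₗ c m = _ ≫ _ ≫ X ⊴ₗ c m
  rw [comp_actionHomLeft_assoc, h₂, comp_actionHomLeft_assoc,
    whiskerLeft_actionHomLeft, whiskerRight_actionHomLeft]
  simp only [Category.assoc, Iso.inv_hom_id_assoc]
  rw [← actionHomRight_comp, h₁, actionHomRight_id, reassoc_of% h₁, braidAct_hom,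
    Iso.hom_inv_id_assoc, Category.comp_id]

/-- This makes the counit a morphism of module functors; it is `halfBraidingIso_app` solved for the
module structure of `F`. -/
lemma counitApp_comm (F : RexMod k C M) (X : C) (m : M) :
    X ⊴ₗ counitApp adj F.toRex m ≫ μₗ F.toRex.obj X m =
      (braidAct (radjHalfBraiding adj F) X m).inv ≫ counitApp adj F.toRex (X ⊙ₗ m) := by
  have e := halfBraidingIso_app adj F X m
  rw [Iso.eq_inv_comp, braidAct_hom]
  simp only [Category.assoc]
  change _ ≫ (halfBraidingIso adj F X).hom ⊵ₗ m ≫ _ = _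
  rw [reassoc_of% e, Iso.inv_hom_id_assoc, Functor.LeftLinear.δₗ_comp_μₗ, Category.comp_id]

/-- The lift of the adjunction `act ⊣ R` to the Drinfeld center and to module functors. -/
def centerAdjunction : centerAct k C M ⊣ radjCenter adj where
  unit :=
    { app V := { f := adj.unit.app V.1, comm := unit_halfBraiding adj V.2 }
      naturality _ _ f := Center.ext _ _ (adj.unit.naturality f.f) }
  counit :=
    { app F := { nat := adj.counit.app F.toRex, comm := counitApp_comm adj F }
      naturality _ _ f := RexMod.Hom.ext (adj.counit.naturality f.nat) }
  left_triangle_components V := RexMod.Hom.ext (adj.left_triangle_components V.1)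
  right_triangle_components F := Center.ext _ _ (adj.right_triangle_components F.toRex)

/-- The wedge of the counit is universal. -/
def isLimitCounitWedge {H : Mᵒᵖ ⥤ M ⥤ C} (hadj : (curriedAction C M).flip ⊣₂ H) (F : Rex k M) :
    IsLimit (counitWedge adj hadj F) :=
  -- The wedge condition transposes to naturality in `m`.
  have hc (s : Wedge (ihomFunctor H F.obj)) {m m' : M} (f : m ⟶ m') :
      s.pt ⊴ₗ f ≫ hadj.homEquiv.symm (s.ι m') = hadj.homEquiv.symm (s.ι m) ≫ F.obj.map f := by
    have e := congrArg hadj.homEquiv.symm (Wedge.condition s f)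
    refine (hadj.homEquiv_symm_naturality_one f (s.ι m')).symm.trans (e.symm.trans ?_)
    exact hadj.homEquiv_symm_naturality_three (F.obj.map f) (s.ι m)
  have hl (s : Wedge (ihomFunctor H F.obj)) (f : s.pt ⟶ R.obj F) (m : M) :
      f ≫ hadj.homEquiv (counitApp adj F m) = s.ι m ↔
        f ⊵ₗ m ≫ counitApp adj F m = hadj.homEquiv.symm (s.ι m) := by
    refine Iff.trans ?_ (Equiv.eq_symm_apply hadj.homEquiv).symm
    exact ⟨fun h => (hadj.homEquiv_naturality_two f _).trans h,
      fun h => (hadj.homEquiv_naturality_two f _).symm.trans h⟩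
  Multifork.IsLimit.mk _ (fun s => mate adj (fun m => hadj.homEquiv.symm (Multifork.ι s m)) (hc s))
    (fun s m => (hl s _ m).2 (mate_app adj _ (hc s) m))
    (fun s f hf => mate_ext adj fun m =>
      ((hl s f m).1 (hf m)).trans (mate_app adj _ (hc s) m).symm)

end CenterAdjunction

end FinTensor

namespace FinTensor
open MonoidalLeftAction

/-! ### The internal Hom from a fixed object as a module functor. -/

section InternalHom
variable {C : Type u₁} [Category.{v} C] [MonoidalCategory C]
  {M : Type u₂} [Category.{v} M] [MonoidalLeftAction C M]
  {p : M} {H : M ⥤ C} (a : actionRight C p ⊣ H)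

/-- The evaluation `Hom(p, m) ⊗ p ⟶ m`. -/
def homEv (m : M) : H.obj m ⊙ₗ p ⟶ m := a.counit.app m

lemma homEv_naturality {m m' : M} (f : m ⟶ m') : H.map f ⊵ₗ p ≫ homEv a m' = homEv a m ≫ f :=
  a.counit.naturality f

/-- The morphism `W ⟶ Hom(p, m)` that corresponds to `W ⊗ p ⟶ m`. -/
def homLift {W : C} {m : M} (t : W ⊙ₗ p ⟶ m) : W ⟶ H.obj m := a.homEquiv W m t

lemma homLift_homEv {W : C} {m : M} (t : W ⊙ₗ p ⟶ m) : homLift a t ⊵ₗ p ≫ homEv a m = t :=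
  (a.homEquiv_counit (g := homLift a t)).symm.trans ((a.homEquiv W m).symm_apply_apply t)

lemma homEv_ext {W : C} {m : M} {f g : W ⟶ H.obj m}
    (h : f ⊵ₗ p ≫ homEv a m = g ⊵ₗ p ≫ homEv a m) : f = g := by
  apply (a.homEquiv W m).symm.injective
  rw [a.homEquiv_counit, a.homEquiv_counit]
  exact h

/-- The module structure `X ⊗ Hom(p, m) ⟶ Hom(p, X ⊗ m)`. -/
def homStr (X : C) (m : M) : X ⊗ H.obj m ⟶ H.obj (X ⊙ₗ m) :=
  homLift a ((αₗ X (H.obj m) p).hom ≫ X ⊴ₗ homEv a m)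

lemma homStr_homEv (X : C) (m : M) : homStr a X m ⊵ₗ p ≫ homEv a (X ⊙ₗ m) =
    (αₗ X (H.obj m) p).hom ≫ X ⊴ₗ homEv a m :=
  homLift_homEv a _

lemma homStr_naturality_left {X Y : C} (f : X ⟶ Y) (m : M) :
    f ▷ H.obj m ≫ homStr a Y m = homStr a X m ≫ H.map (f ⊵ₗ m) := by
  apply homEv_ext a
  rw [comp_actionHomLeft_assoc, comp_actionHomLeft_assoc, homStr_homEv, homEv_naturality,
    reassoc_of% homStr_homEv, whiskerRight_actionHomLeft, action_exchange]
  simp only [Category.assoc, Iso.inv_hom_id_assoc]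

lemma homStr_naturality_right (X : C) {m m' : M} (f : m ⟶ m') :
    X ◁ H.map f ≫ homStr a X m' = homStr a X m ≫ H.map (X ⊴ₗ f) := by
  apply homEv_ext a
  rw [comp_actionHomLeft_assoc, comp_actionHomLeft_assoc, homStr_homEv, homEv_naturality,
    reassoc_of% homStr_homEv, whiskerLeft_actionHomLeft, ← actionHomRight_comp,
    ← homEv_naturality, actionHomRight_comp]
  simp only [Category.assoc, Iso.inv_hom_id_assoc]

lemma homStr_tensor (X Y : C) (m : M) :
    homStr a (X ⊗ Y) m ≫ H.map (αₗ X Y m).hom =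
      (α_ X Y (H.obj m)).hom ≫ X ◁ homStr a Y m ≫ homStr a X (Y ⊙ₗ m) := by
  apply homEv_ext a
  simp only [comp_actionHomLeft, Category.assoc]
  rw [homStr_homEv, homEv_naturality, reassoc_of% homStr_homEv, whiskerLeft_actionHomLeft,
    associator_act]
  simp only [Category.assoc, Iso.inv_hom_id_assoc]
  rw [← actionHomRight_comp, homStr_homEv]
  simp

section
variable (X D : C) [ExactPairing X D]

/-- The mate used for the inverse of `homStr`. -/
def homStrAux (m : M) : D ⊗ H.obj (X ⊙ₗ m) ⟶ H.obj m :=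
  homLift a ((αₗ _ _ p).hom ≫ D ⊴ₗ homEv a (X ⊙ₗ m) ≫
    (αₗ D X m).inv ≫ (ε_ X D) ⊵ₗ m ≫ (λₗ m).hom)

lemma homStrAux_homEv (m : M) : homStrAux a X D m ⊵ₗ p ≫ homEv a m =
    (αₗ _ _ p).hom ≫ D ⊴ₗ homEv a (X ⊙ₗ m) ≫
      (αₗ D X m).inv ≫ (ε_ X D) ⊵ₗ m ≫ (λₗ m).hom :=
  homLift_homEv a _

/-- The inverse of `homStr`, for a dual `D` of `X`. -/
def homStrInv (m : M) : H.obj (X ⊙ₗ m) ⟶ X ⊗ H.obj m :=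
  (λ_ _).inv ≫ (η_ X D) ▷ _ ≫ (α_ _ _ _).hom ≫ X ◁ homStrAux a X D m

lemma homStrInv_comp (m : M) : homStrInv a X D m ≫ homStr a X m = 𝟙 _ := by
  apply homEv_ext a
  rw [comp_actionHomLeft_assoc, homStr_homEv, homStrInv]
  simp only [comp_actionHomLeft, whiskerLeft_actionHomLeft, whiskerRight_actionHomLeft,
    associator_act, leftUnitor_inv_act, homStrAux_homEv, Category.assoc, Iso.inv_hom_id_assoc,
    ← actionHomRight_comp, id_actionHomLeft, Category.id_comp]
  rw [actionHomRight_comp, reassoc_of% assoc_hom_naturality,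
    ← action_exchange_assoc, actionUnitIso_inv_naturality_assoc, zigzag₁, Category.comp_id]

lemma homStr_comp (m : M) : homStr a X m ≫ homStrInv a X D m = 𝟙 _ := by
  -- The mate was built by evaluating `D` against `X`, so precomposing it with `homStr` leaves only
  -- the evaluation; a zigzag identity then finishes.
  have e : D ◁ homStr a X m ≫ homStrAux a X D m =
      (α_ _ _ _).inv ≫ (ε_ X D) ▷ _ ≫ (λ_ _).hom := by
    apply homEv_ext a
    rw [comp_actionHomLeft_assoc, homStrAux_homEv]
    simp only [comp_actionHomLeft, whiskerLeft_actionHomLeft, whiskerRight_actionHomLeft,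
      associator_inv_act, leftUnitor_actionHom, Category.assoc, Iso.inv_hom_id_assoc]
    rw [← actionHomRight_comp_assoc, homStr_homEv, actionHomRight_comp_assoc,
      reassoc_of% assoc_inv_naturality, action_exchange_assoc, actionUnitIso_hom_naturality]
  rw [homStrInv, leftUnitor_inv_naturality_assoc, whisker_exchange_assoc,
    associator_naturality_right_assoc, ← MonoidalCategory.whiskerLeft_comp, e]
  calc
    _ = 𝟙 _ ⊗≫ ((η_ X D) ▷ X ⊗≫ X ◁ (ε_ X D)) ▷ H.obj m ⊗≫ 𝟙 _ := by monoidal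
    _ = _ := by rw [ExactPairing.evaluation_coevaluation'']; monoidal

end

variable [RigidCategory C]

/-- `homStr` as an isomorphism. -/
@[simps]
def homStrIso (X : C) (m : M) : X ⊗ H.obj m ≅ H.obj (X ⊙ₗ m) where
  hom := homStr a X m
  inv := homStrInv a X Xᘁ m
  hom_inv_id := homStr_comp a X Xᘁ m
  inv_hom_id := homStrInv_comp a X Xᘁ m

/-- The isomorphism `Hom(p, X ⊗ m) ⊗ n ≅ X ⊗ Hom(p, m) ⊗ n`. -/
def homActIso (n : M) (X : C) (m : M) : H.obj (X ⊙ₗ m) ⊙ₗ n ≅ X ⊙ₗ H.obj m ⊙ₗ n where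
  hom := (homStrIso a X m).inv ⊵ₗ n ≫ (αₗ X (H.obj m) n).hom
  inv := (αₗ X (H.obj m) n).inv ≫ homStr a X m ⊵ₗ n
  hom_inv_id := by
    rw [Category.assoc, Iso.hom_inv_id_assoc, ← comp_actionHomLeft, ← homStrIso_hom,
      Iso.inv_hom_id, id_actionHomLeft]
  inv_hom_id := by
    rw [Category.assoc, ← comp_actionHomLeft_assoc, ← homStrIso_hom,
      Iso.hom_inv_id, id_actionHomLeft, Category.id_comp, Iso.inv_hom_id]

/-- This determines `homActIso` without reference to the inverse of `homStr`: each coherence below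
follows by cancelling the epimorphism `homStr a X m ⊵ₗ n`. -/
lemma homActIso_hom (n : M) (X : C) (m : M) :
    homStr a X m ⊵ₗ n ≫ (homActIso a n X m).hom = (αₗ X (H.obj m) n).hom := by
  rw [← Iso.eq_comp_inv]
  simp [homActIso]

instance epi_homStr_act (X : C) (m n : M) : Epi (homStr a X m ⊵ₗ n) := by
  rw [← homStrIso_hom]
  infer_instance

lemma homActIso_naturality_left (n : M) {X Y : C} (f : X ⟶ Y) (m : M) :
    H.map (f ⊵ₗ m) ⊵ₗ n ≫ (homActIso a n Y m).hom =
      (homActIso a n X m).hom ≫ f ⊵ₗ (H.obj m ⊙ₗ n) := by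
  rw [← cancel_epi (homStr a X m ⊵ₗ n), ← comp_actionHomLeft_assoc, ← homStr_naturality_left,
    comp_actionHomLeft_assoc, homActIso_hom, reassoc_of% (homActIso_hom a n X m),
    whiskerRight_actionHomLeft]
  simp

lemma homActIso_naturality_right (n : M) (X : C) {m m' : M} (f : m ⟶ m') :
    H.map (X ⊴ₗ f) ⊵ₗ n ≫ (homActIso a n X m').hom =
      (homActIso a n X m).hom ≫ X ⊴ₗ H.map f ⊵ₗ n := by
  rw [← cancel_epi (homStr a X m ⊵ₗ n), ← comp_actionHomLeft_assoc, ← homStr_naturality_right,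
    comp_actionHomLeft_assoc, homActIso_hom, reassoc_of% (homActIso_hom a n X m),
    whiskerLeft_actionHomLeft]
  simp

lemma homActIso_tensor (n : M) (X Y : C) (m : M) :
    (homActIso a n (X ⊗ Y) m).hom ≫ (αₗ X Y (H.obj m ⊙ₗ n)).hom =
      H.map (αₗ X Y m).hom ⊵ₗ n ≫ (homActIso a n X (Y ⊙ₗ m)).hom ≫
        X ⊴ₗ (homActIso a n Y m).hom := by
  rw [← cancel_epi (homStr a (X ⊗ Y) m ⊵ₗ n), ← comp_actionHomLeft_assoc, homStr_tensor,
    reassoc_of% (homActIso_hom a n (X ⊗ Y) m)]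
  simp only [comp_actionHomLeft, Category.assoc]
  rw [reassoc_of% homActIso_hom, whiskerLeft_actionHomLeft, associator_act]
  simp only [Category.assoc, Iso.inv_hom_id_assoc]
  rw [← actionHomRight_comp, homActIso_hom]
  simp

lemma homActIso_naturality {n n' : M} (f : n ⟶ n') (X : C) (m : M) :
    H.obj (X ⊙ₗ m) ⊴ₗ f ≫ (homActIso a n' X m).hom =
      (homActIso a n X m).hom ≫ X ⊴ₗ H.obj m ⊴ₗ f := by
  rw [← cancel_epi (homStr a X m ⊵ₗ n), ← action_exchange_assoc, homActIso_hom,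
    reassoc_of% (homActIso_hom a n X m), assoc_hom_naturality]

end InternalHom
end FinTensor

/-! ### Right exactness of the internal Hom from a projective object. -/

namespace FinTensor
open MonoidalLeftAction Functor.LaxLeftLinear Functor.OplaxLeftLinear

/-- A right adjoint is left exact, so between abelian categories only the preservation of
epimorphisms is missing. -/
lemma preservesFiniteColimits_of_isRightAdjoint_of_epi {A B : Type*} [Category* A] [Category* B]
    [Abelian A] [Abelian B] (G : A ⥤ B) [G.Additive] [G.IsRightAdjoint]
    (h : ∀ {X Y : A} (f : X ⟶ Y) [Epi f], Epi (G.map f)) : PreservesFiniteColimits G := by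
  have h₁ := (Functor.preservesFiniteLimits_iff_forall_exact_map_and_mono G).1 inferInstance
  rw [Functor.preservesFiniteColimits_iff_forall_exact_map_and_epi]
  exact fun S hS => ⟨(h₁ S hS).1, have := hS.epi_g; h S.g⟩

section HomFunctor
variable (k : Type v) [Field k]
  {C : Type u₁} [Category.{v} C] [MonoidalCategory C] [Preadditive C] [Linear k C]
  [IsFiniteAbelian k C] [RigidCategory C]
  {M : Type u₂} [Category.{v} M] [Preadditive M] [Linear k M] [MonoidalLeftAction C M]
  [IsFiniteLeftModuleCategory k C M]
  {p : M} {H : M ⥤ C} (a : actionRight C p ⊣ H)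

include k a

omit [IsFiniteAbelian k C] [RigidCategory C] in
lemma additive_of_actionRight_adjunction : H.Additive :=
  have : (actionRight C p).Additive := IsFiniteLeftModuleCategory.additive_actionRight k p
  a.right_adjoint_additive

omit [IsFiniteAbelian k C] [RigidCategory C] in
lemma linear_of_actionRight_adjunction : H.Linear k where
  map_smul {X Y} f c := by
    have := IsFiniteLeftModuleCategory.linear_actionRight (k := k) (C := C) p
    apply homEv_ext a
    have e {W V : C} (g : W ⟶ V) : (c • g) ⊵ₗ p = c • g ⊵ₗ p :=
      (actionRight C p).map_smul c g
    rw [homEv_naturality, e, Linear.smul_comp, homEv_naturality, Linear.comp_smul]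

/-- The internal Hom functor of a projective object is right exact. -/
lemma rightExact_of_actionRight_adjunction [Projective p] : PreservesFiniteColimits H := by
  have hC : IsFiniteAbelian k C := inferInstance
  have hM : IsFiniteAbelian k M := IsFiniteLeftModuleCategory.finiteAbelian C
  let _ := hC.abelian
  let _ := hM.abelian
  obtain ⟨Q, _, hs⟩ := hC.exists_projective_separator
  have := additive_of_actionRight_adjunction k a
  have : H.IsRightAdjoint := ⟨_, ⟨a⟩⟩
  refine preservesFiniteColimits_of_isRightAdjoint_of_epi H fun {m n} f _ => ?_
  -- By transposition this is a lifting problem for `Q ⊗ p`, which is projective since `Q ⊗ -` has a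
  -- right exact right adjoint, the action of `ᘁQ`.
  have lift (t : Q ⟶ H.obj n) : ∃ s : Q ⟶ H.obj m, s ≫ H.map f = t := by
    let adj : actionLeft M Q ⊣ actionLeft M (ᘁQ) := actionLeftAdjunction (ᘁQ) Q
    have : PreservesFiniteColimits (actionLeft M (ᘁQ)) :=
      IsFiniteLeftModuleCategory.rightExact_actionLeft k _
    have : Projective (Q ⊙ₗ p) := adj.map_projective p inferInstance
    let s : Q ⊙ₗ p ⟶ m := Projective.factorThru (t ⊵ₗ p ≫ homEv a n) f
    refine ⟨homLift a s, homEv_ext a ?_⟩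
    rw [comp_actionHomLeft_assoc, homEv_naturality, reassoc_of% homLift_homEv,
      Projective.factorThru_comp]
  refine Preadditive.epi_of_cancel_zero _ fun g hg => eq_zero_of_separator hs g fun t => ?_
  obtain ⟨s, rfl⟩ := lift t
  rw [Category.assoc, hg, comp_zero]

omit k a [IsFiniteAbelian k C] in
/-- The module functor `m ↦ Hom(p, m) ⊗ n` for a projective object `p`. -/
def homAct [Projective p] (n : M) : RexMod k C M where
  toRex := ⟨H ⋙ actionRight C n, by
    have := additive_of_actionRight_adjunction k a
    have := linear_of_actionRight_adjunction k a
    have := rightExact_of_actionRight_adjunction k a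
    have := IsFiniteLeftModuleCategory.additive_actionRight (C := C) k n
    have := IsFiniteLeftModuleCategory.linear_actionRight (k := k) (C := C) n
    have := IsFiniteLeftModuleCategory.rightExact_actionRight (C := C) k n
    exact ⟨inferInstance, inferInstance, Limits.comp_preservesFiniteColimits _ _⟩⟩
  leftLinear := leftLinearOfIso (H ⋙ actionRight C n) (homActIso a n)
    (homActIso_naturality_left a n) (homActIso_naturality_right a n) (homActIso_tensor a n)

end HomFunctor

/-! ### Faithfulness of the action on a nonzero module category. -/

section Faithful
variable (k : Type v) [Field k]
  {C : Type u₁} [Category.{v} C] [MonoidalCategory C] [Preadditive C] [Linear k C]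
  [MonoidalPreadditive C] [RigidCategory C] [IsFiniteAbelian k C] [Simple (𝟙_ C)]
  {M : Type u₂} [Category.{v} M] [Preadditive M] [Linear k M] [MonoidalLeftAction C M]
  [IsFiniteLeftModuleCategory k C M]

include k

omit [MonoidalPreadditive C] [RigidCategory C] in
lemma epi_of_nonzero_to_unit {X : C} {f : X ⟶ 𝟙_ C} (hf : f ≠ 0) : Epi f := by
  have hC : IsFiniteAbelian k C := inferInstance
  let _ := hC.abelian
  exact epi_of_nonzero_to_simple hf

omit [MonoidalPreadditive C] [RigidCategory C] [IsFiniteAbelian k C] [Simple (𝟙_ C)] in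
lemma epi_actionHomLeft {X Y : C} (f : X ⟶ Y) [Epi f] (m : M) : Epi (f ⊵ₗ m) :=
  have := IsFiniteLeftModuleCategory.rightExact_actionRight (C := C) k m
  inferInstanceAs (Epi ((actionRight C m).map f))

/-- A nonzero `f` would transpose to a nonzero `X ⊗ ᘁY ⟶ 𝟙`, which is epi as the unit is simple. It
factors through `f ▷ ᘁY`, so it would act on `n` both by zero and by an epimorphism onto `𝟙 ⊗ n ≅
n`. -/
lemma eq_zero_of_actionHomLeft_eq_zero (hM : ∃ m : M, ¬ IsZero m) {X Y : C} (f : X ⟶ Y)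
    (h : ∀ m : M, f ⊵ₗ m = 0) : f = 0 := by
  by_contra hf
  obtain ⟨n, hn⟩ := hM
  let e := tensorRightHomEquiv X (ᘁY : C) Y (𝟙_ C)
  have e₀ : e.symm 0 = 0 := by simp [e, tensorRightHomEquiv]
  let g : X ⊗ (ᘁY : C) ⟶ 𝟙_ C := e.symm (f ≫ (λ_ Y).inv)
  have hg : g ≠ 0 := fun h0 => hf (by
    have := e.symm.injective (h0.trans e₀.symm)
    rw [← cancel_mono (λ_ Y).inv, this, zero_comp])
  have := epi_of_nonzero_to_unit k hg
  have := epi_actionHomLeft k g n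
  have h₁ : g ⊵ₗ n = 0 := by
    have : (f ▷ (ᘁY : C)) ⊵ₗ n = 0 := by
      rw [whiskerRight_actionHomLeft, h, zero_comp, comp_zero]
    have e₁ : g = f ▷ (ᘁY : C) ≫ (tensorRightHomEquiv Y (ᘁY : C) Y (𝟙_ C)).symm (λ_ Y).inv :=
      tensorRightHomEquiv_symm_naturality _ _
    rw [e₁, comp_actionHomLeft, this, zero_comp]
  refine hn ((IsZero.of_epi_eq_zero _ h₁).of_iso (λₗ n).symm)

lemma actionHomLeft_ext (hM : ∃ m : M, ¬ IsZero m) {X Y : C} {f g : X ⟶ Y}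
    (h : ∀ m : M, f ⊵ₗ m = g ⊵ₗ m) : f = g := by
  rw [← sub_eq_zero]
  refine eq_zero_of_actionHomLeft_eq_zero k hM _ fun m => ?_
  have := IsFiniteLeftModuleCategory.additive_actionRight (C := C) k m
  exact ((actionRight C m).map_sub).trans (sub_eq_zero.2 (h m))

-- A zigzag identity factors the identity of `X` through the evaluation.
omit [RigidCategory C] in
omit [IsFiniteAbelian k C] k [Simple (𝟙_ C)] in
lemma evaluation_ne_zero {X D : C} [ExactPairing D X] (hX : ¬ IsZero X) : ε_ D X ≠ 0 := by
  intro h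
  have e := ExactPairing.coevaluation_evaluation D X
  rw [h] at e
  apply hX
  rw [IsZero.iff_id_eq_zero, ← cancel_epi (ρ_ X).hom, ← cancel_mono (λ_ X).inv, Category.comp_id,
    ← e]
  simp

-- The morphism `f` corresponds to a nonzero `𝟙 ⟶ Hom(p, m)`.
omit [MonoidalPreadditive C] [RigidCategory C] [IsFiniteAbelian k C] [Simple (𝟙_ C)] in
lemma not_isZero_of_actionRight_adjunction {p m : M} {H : M ⥤ C} (a : actionRight C p ⊣ H)
    (f : p ⟶ m) (hf : f ≠ 0) : ¬ IsZero (H.obj m) := by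
  intro h
  have h₁ := homLift_homEv a ((λₗ[C] p).hom ≫ f)
  have := IsFiniteLeftModuleCategory.additive_actionRight (C := C) k p
  have h₂ : (0 : 𝟙_ C ⟶ H.obj m) ⊵ₗ p = 0 := (actionRight C p).map_zero _ _
  rw [h.eq_of_tgt (homLift a ((λₗ[C] p).hom ≫ f)) 0, h₂, zero_comp] at h₁
  apply hf
  rw [← cancel_epi (λₗ[C] p).hom, ← h₁, comp_zero]

end Faithful
end FinTensor

/-! ### The double centralizer property for morphisms. -/

namespace FinTensor
open MonoidalLeftAction Functor.LaxLeftLinear Functor.OplaxLeftLinear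

section EvaluationAction
variable {C : Type u₁} [Category.{v} C] [MonoidalCategory C]
  {M : Type u₂} [Category.{v} M] [MonoidalLeftAction C M] (X D : C) [ExactPairing X D]

/-- The action `D ⊗ X ⊗ m ⟶ m` of the evaluation of a dual pair. -/
def evAct (m : M) : D ⊙ₗ X ⊙ₗ m ⟶ m := (αₗ D X m).inv ≫ (ε_ X D) ⊵ₗ m ≫ (λₗ m).hom

lemma evAct_natural {m m' : M} (f : m ⟶ m') :
    D ⊴ₗ X ⊴ₗ f ≫ evAct X D m' = evAct X D m ≫ f :=
  evAct_naturality X D f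

/-- The morphism `(Z ⊗ D) ⊗ X ⟶ Z` given by the evaluation of a dual pair. -/
def tensorEv (Z : C) : (Z ⊗ D) ⊗ X ⟶ Z := (α_ Z D X).hom ≫ Z ◁ (ε_ X D) ≫ (ρ_ Z).hom

lemma tensorEv_act (Z : C) (m : M) : tensorEv X D Z ⊵ₗ m =
    (αₗ (Z ⊗ D) X m).hom ≫ (αₗ Z D (X ⊙ₗ m)).hom ≫ Z ⊴ₗ evAct X D m := by
  simp only [tensorEv, evAct, comp_actionHomLeft, associator_act, whiskerLeft_actionHomLeft,
    rightUnitor_actionHom, actionHomRight_comp, Category.assoc, Iso.inv_hom_id_assoc]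

end EvaluationAction

section Central
variable {k : Type v} [Field k]
  {C : Type u₁} [Category.{v} C] [MonoidalCategory C]
  {M : Type u₂} [Category.{v} M] [Preadditive M] [Linear k M] [MonoidalLeftAction C M]

variable (k) in
/-- A natural transformation between functors `X ⊗ -` and `Y ⊗ -` that commutes with all module
functors in the dual category. -/
structure IsCentral {X Y : C} (ψ : ∀ m : M, X ⊙ₗ m ⟶ Y ⊙ₗ m) : Prop where
  naturality {m m' : M} (f : m ⟶ m') : X ⊴ₗ f ≫ ψ m' = ψ m ≫ Y ⊴ₗ f
  comm (G : RexMod k C M) (m : M) :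
    G.toRex.obj.map (ψ m) ≫ δₗ G.toRex.obj Y m = δₗ G.toRex.obj X m ≫ ψ (G.toRex.obj.obj m)

variable [Preadditive C] [Linear k C]
  [MonoidalPreadditive C] [RigidCategory C] [IsFiniteAbelian k C] [Simple (𝟙_ C)]
  [IsFiniteLeftModuleCategory k C M]

-- Descent along `q`: by faithfulness `h` kills the kernel of `q`, hence factors as `q ≫ f`, and `q`
-- acts by epimorphisms.
include k in
variable (k) in
lemma exists_actionHomLeft_of_epi (hM : ∃ m : M, ¬ IsZero m) {X Y Z : C} (q : Z ⟶ X) [Epi q]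
    (h : Z ⟶ Y) (ψ : ∀ m : M, X ⊙ₗ m ⟶ Y ⊙ₗ m) (hψ : ∀ m, h ⊵ₗ m = q ⊵ₗ m ≫ ψ m) :
    ∃ f : X ⟶ Y, ∀ m, ψ m = f ⊵ₗ m := by
  have hC : IsFiniteAbelian k C := inferInstance
  let _ := hC.abelian
  have h₀ : kernel.ι q ≫ h = 0 := eq_zero_of_actionHomLeft_eq_zero k hM _ fun m => by
    have := IsFiniteLeftModuleCategory.additive_actionRight (C := C) k m
    have e : (0 : kernel q ⟶ X) ⊵ₗ m = 0 := (actionRight C m).map_zero _ _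
    rw [comp_actionHomLeft, hψ, ← comp_actionHomLeft_assoc, kernel.condition, e, zero_comp]
  let f := (Abelian.epiIsCokernelOfKernel _ (kernelIsKernel q)).desc
    (CokernelCofork.ofπ h h₀)
  have hf : q ≫ f = h := (Abelian.epiIsCokernelOfKernel _ (kernelIsKernel q)).fac
    (CokernelCofork.ofπ h h₀) WalkingParallelPair.one
  refine ⟨f, fun m => ?_⟩
  have := epi_actionHomLeft k q m
  rw [← cancel_epi (q ⊵ₗ m), ← hψ, ← comp_actionHomLeft, hf]

-- The evaluation is nonzero with simple target, hence epi, and `Z ⊗ -` is a left adjoint.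
include k in
variable (k) in
lemma epi_tensorEv (X D : C) [ExactPairing X D] (hD : ¬ IsZero D) (Z : C) :
    Epi (tensorEv X D Z) := by
  have := epi_of_nonzero_to_unit k (evaluation_ne_zero (X := D) (D := X) hD)
  have : (tensorLeft Z).IsLeftAdjoint := ⟨_, ⟨tensorLeftAdjunction (ᘁZ : C) Z⟩⟩
  have : Epi (Z ◁ (ε_ X D)) := inferInstanceAs (Epi ((tensorLeft Z).map (ε_ X D)))
  unfold tensorEv
  infer_instance

/-- Natural transformations that commute with the dual category come from the category that acts,
the double centralizer property for morphisms. -/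
lemma IsCentral.exists_eq {p : M} [Projective p] {H : M ⥤ C} (a : actionRight C p ⊣ H)
    (hp : ¬ IsZero p)
    {X Y : C} {ψ : ∀ m : M, X ⊙ₗ m ⟶ Y ⊙ₗ m} (hψ : IsCentral k ψ) :
    ∃ f : X ⟶ Y, ∀ m, ψ m = f ⊵ₗ m := by
  have hB : ¬ IsZero (H.obj p) := not_isZero_of_actionRight_adjunction k a (𝟙 p)
    (fun h => hp ((IsZero.iff_id_eq_zero p).2 h))
  let B := H.obj p
  let B' : C := ᘁB
  -- The morphism `H.map (ψ p)` transported along `homStr`. Centrality against `Hom(p, -) ⊗ n` at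
  -- `p` identifies its action on `n` with `ψ` at `B ⊗ n`.
  let T : X ⊗ B ⟶ Y ⊗ B := homStr a X p ≫ H.map (ψ p) ≫ (homStrIso a Y p).inv
  have hT (n : M) : T ⊵ₗ n ≫ (αₗ Y B n).hom = (αₗ X B n).hom ≫ ψ (B ⊙ₗ n) := by
    have e : H.map (ψ p) ⊵ₗ n ≫ (homActIso a n Y p).hom = (homActIso a n X p).hom ≫ ψ (B ⊙ₗ n) :=
      hψ.comm (homAct k a n) p
    have e' := congrArg (homStr a X p ⊵ₗ n ≫ ·) e
    rw [reassoc_of% homActIso_hom] at e'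
    simp only [T, comp_actionHomLeft, Category.assoc]
    exact e'
  have : Epi (tensorEv B' B X) := epi_tensorEv k B' B hB X
  -- Naturality of `ψ` along the evaluation `B ⊗ B' ⊗ n ⟶ n` passes from `ψ` at `B ⊗ B' ⊗ n`, the
  -- action of `T`, to `ψ` at `n`.
  refine exists_actionHomLeft_of_epi k ⟨p, hp⟩ (tensorEv B' B X) (T ▷ B' ≫ tensorEv B' B Y) ψ
    fun n => ?_
  simp only [comp_actionHomLeft, tensorEv_act, whiskerRight_actionHomLeft, Category.assoc,
    Iso.inv_hom_id_assoc]
  rw [reassoc_of% hT, hψ.naturality]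

end Central
end FinTensor

/-! ### Half-braidings in the dual category, componentwise. -/

namespace FinTensor
open MonoidalLeftAction Functor.LaxLeftLinear Functor.OplaxLeftLinear

section HalfBraidingComponents
variable {k : Type v} [Field k]
  {C : Type u₁} [Category.{v} C] [MonoidalCategory C]
  {M : Type u₂} [Category.{v} M] [Preadditive M] [Linear k M] [MonoidalLeftAction C M]

/-- The underlying functor of a module functor. -/
abbrev RexMod.functor (F : RexMod k C M) : M ⥤ M := F.toRex.obj

/-- A natural transformation that is compatible with the inverse module structures is a morphism of
module functors. -/
lemma RexMod.comm_of_comm_δ {F G : RexMod k C M} (t : F.toRex ⟶ G.toRex)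
    (h : ∀ (X : C) (m : M), t.hom.app (X ⊙ₗ m) ≫ δₗ G.functor X m =
      δₗ F.functor X m ≫ X ⊴ₗ t.hom.app m) (X : C) (m : M) :
    X ⊴ₗ t.hom.app m ≫ μₗ G.functor X m = μₗ F.functor X m ≫ t.hom.app (X ⊙ₗ m) := by
  rw [← cancel_epi (δₗ F.functor X m), ← reassoc_of% h]
  simp

variable {F : RexMod k C M} (b : HalfBraiding F)

/-- The component `G(F(m)) ≅ F(G(m))` of a half-braiding of `F` in the dual category. -/
def hbIso (G : RexMod k C M) (m : M) :
    G.functor.obj (F.functor.obj m) ≅ F.functor.obj (G.functor.obj m) where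
  hom := (b.β G).hom.nat.hom.app m
  inv := (b.β G).inv.nat.hom.app m
  hom_inv_id := congrArg (fun t : F ⊗ G ⟶ F ⊗ G => t.nat.hom.app m) (b.β G).hom_inv_id
  inv_hom_id := congrArg (fun t : G ⊗ F ⟶ G ⊗ F => t.nat.hom.app m) (b.β G).inv_hom_id

lemma hbIso_naturality (G : RexMod k C M) {m m' : M} (f : m ⟶ m') :
    G.functor.map (F.functor.map f) ≫ (hbIso b G m').hom =
      (hbIso b G m).hom ≫ F.functor.map (G.functor.map f) :=
  (b.β G).hom.nat.hom.naturality f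

lemma hbIso_naturality_functor {G G' : RexMod k C M} (t : G ⟶ G') (m : M) :
    t.nat.hom.app (F.functor.obj m) ≫ (hbIso b G' m).hom =
      (hbIso b G m).hom ≫ F.functor.map (t.nat.hom.app m) :=
  congrArg (fun t : F ⊗ G ⟶ G' ⊗ F => t.nat.hom.app m) (b.naturality t)

lemma hbIso_tensor (G G' : RexMod k C M) (m : M) :
    (hbIso b (G ⊗ G') m).hom =
      G'.functor.map (hbIso b G m).hom ≫ (hbIso b G' (G.functor.obj m)).hom := by
  refine (congrArg (fun t : F ⊗ (G ⊗ G') ⟶ (G ⊗ G') ⊗ F => t.nat.hom.app m)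
    (b.monoidal G G')).trans ?_
  simp only [RexMod.comp_nat, ObjectProperty.FullSubcategory.comp_hom, NatTrans.comp_app,
    RexMod.associator_inv_app, RexMod.associator_hom_app, RexMod.whiskerRight_app,
    RexMod.whiskerLeft_app]
  refine (Category.id_comp _).trans (congrArg _ ?_)
  exact (Category.id_comp _).trans (Category.comp_id _)

/-- The component of the half-braiding at `G` is itself a morphism of module functors between the
two composites of `F` and `G`. -/
lemma hbIso_δ (G : RexMod k C M) (X : C) (m : M) :
    (hbIso b G (X ⊙ₗ m)).hom ≫ F.functor.map (δₗ G.functor X m) ≫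
        δₗ F.functor X (G.functor.obj m) =
      G.functor.map (δₗ F.functor X m) ≫ δₗ G.functor X (F.functor.obj m) ≫
        X ⊴ₗ (hbIso b G m).hom :=
  ((b.β G).hom.comm_δ X m).trans (Category.assoc _ _ _)

end HalfBraidingComponents

section EvaluationModule
variable {C : Type u₁} [Category.{v} C] [MonoidalCategory C]
  {M : Type u₂} [Category.{v} M] [MonoidalLeftAction C M] (X D : C) [ExactPairing X D]

/-- Naturality of `δₗ` along the evaluation, combined with its associativity and unit coherence. -/
lemma δₗ_evAct (G : M ⥤ M) [G.LeftLinear C] (m : M) :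
    δₗ G D (X ⊙ₗ m) ≫ D ⊴ₗ δₗ G X m ≫ evAct X D (G.obj m) = G.map (evAct X D m) := by
  have e₁ := δₗ_naturality_left G (ε_ X D) m
  have e₂ : δₗ G (𝟙_ C) m ≫ (λₗ (G.obj m)).hom = G.map (λₗ m).hom := δₗ_unitality_hom G m
  rw [evAct, evAct, G.map_comp, G.map_comp, ← e₂, reassoc_of% e₁, δₗ_associativity_inv_assoc]

end EvaluationModule

/-! ### The half-braiding tested on the functors `Hom(p, -) ⊗ n`. -/

section HomAct
variable {k : Type v} [Field k]
  {C : Type u₁} [Category.{v} C] [MonoidalCategory C] [Preadditive C] [Linear k C]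
  [RigidCategory C] [IsFiniteAbelian k C]
  {M : Type u₂} [Category.{v} M] [Preadditive M] [Linear k M] [MonoidalLeftAction C M]
  [IsFiniteLeftModuleCategory k C M]
  {p : M} [Projective p] {H : M ⥤ C} (a : actionRight C p ⊣ H)

/-- The module functor `m ↦ Hom(p, m) ⊗ n` is functorial in `n`. -/
def homActMap {n n' : M} (f : n ⟶ n') : homAct k a n ⟶ homAct k a n' where
  nat := ObjectProperty.homMk
    { app m := H.obj m ⊴ₗ f
      naturality _ _ g := (action_exchange (H.map g) f).symm }
  comm := RexMod.comm_of_comm_δ (F := homAct k a n) (G := homAct k a n') _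
    fun X m => homActIso_naturality a f X m

omit [Preadditive C] [Preadditive M] [Projective p] in
lemma δₗ_homActIso (G : M ⥤ M) [G.LeftLinear C] (n : M) (X : C) (m : M) :
    G.map (homActIso a n X m).hom ≫ δₗ G X (H.obj m ⊙ₗ n) ≫ X ⊴ₗ δₗ G (H.obj m) n =
      δₗ G (H.obj (X ⊙ₗ m)) n ≫ (homActIso a (G.obj n) X m).hom := by
  rw [← cancel_epi (G.map ((homStrIso a X m).hom ⊵ₗ n)), ← G.map_comp_assoc, homStrIso_hom,
    homActIso_hom, ← δₗ_associativity, reassoc_of% (δₗ_naturality_left G), homActIso_hom]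

/-- A module functor `G` sends `Hom(p, m) ⊗ n` to `Hom(p, m) ⊗ G(n)`. -/
def homActStr (G : RexMod k C M) (n : M) :
    homAct k a n ⊗ G ⟶ homAct k a (G.functor.obj n) where
  nat := ObjectProperty.homMk
    { app m := δₗ G.functor (H.obj m) n
      naturality _ _ g := δₗ_naturality_left G.functor (H.map g) n }
  comm := RexMod.comm_of_comm_δ (F := homAct k a n ⊗ G) (G := homAct k a (G.functor.obj n)) _
    fun X m => ((δₗ_homActIso a G.functor n X m).symm.trans (Category.assoc _ _ _).symm)

variable {F : RexMod k C M} (b : HalfBraiding F)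

/-- The half-braiding of `F` gives an isomorphism `Hom(p, F(p)) ⊗ n ≅ F(Hom(p, p) ⊗ n)`. -/
def hbHomAct (n : M) :
    H.obj (F.functor.obj p) ⊙ₗ n ≅ F.functor.obj (H.obj p ⊙ₗ n) :=
  hbIso b (homAct k a n) p

lemma hbHomAct_naturality {n n' : M} (f : n ⟶ n') :
    H.obj (F.functor.obj p) ⊴ₗ f ≫ (hbHomAct a b n').hom =
      (hbHomAct a b n).hom ≫ F.functor.map (H.obj p ⊴ₗ f) :=
  hbIso_naturality_functor b (homActMap a f) p

/-- Naturality of the half-braiding along `homActStr a G n`; `hbIso_tensor` splits the component at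
its source `homAct k a n ⊗ G`. -/
lemma hbHomAct_δ (G : RexMod k C M) (n : M) :
    G.functor.map (hbHomAct a b n).hom ≫ (hbIso b G (H.obj p ⊙ₗ n)).hom ≫
        F.functor.map (δₗ G.functor (H.obj p) n) =
      δₗ G.functor (H.obj (F.functor.obj p)) n ≫ (hbHomAct a b (G.functor.obj n)).hom := by
  have e := hbIso_naturality_functor b (homActStr a G n) p
  rw [hbIso_tensor] at e
  exact (Category.assoc _ _ _).symm.trans e.symm

end HomAct
end FinTensor

namespace FinTensor
open MonoidalLeftAction Functor.LaxLeftLinear Functor.OplaxLeftLinear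

/-! ### Central functors are given by the action of an object. -/

section Descent
variable {k : Type v} [Field k]
  {C : Type u₁} [Category.{v} C] [MonoidalCategory C] [Preadditive C] [Linear k C]
  [RigidCategory C] [IsFiniteAbelian k C]
  {M : Type u₂} [Category.{v} M] [Preadditive M] [Linear k M] [MonoidalLeftAction C M]
  [IsFiniteLeftModuleCategory k C M]
  {p : M} [Projective p] {H : M ⥤ C} (a : actionRight C p ⊣ H)
  {F : RexMod k C M} (b : HalfBraiding F) (B' : C)

/-- The isomorphism `(Hom(p, F(p)) ⊗ B') ⊗ n ≅ F(Hom(p, p) ⊗ B' ⊗ n)`. -/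
def freeIso (n : M) :
    (H.obj (F.functor.obj p) ⊗ B') ⊙ₗ n ≅ F.functor.obj (H.obj p ⊙ₗ B' ⊙ₗ n) :=
  αₗ _ _ n ≪≫ hbHomAct a b (B' ⊙ₗ n)

lemma freeIso_hom (n : M) : (freeIso a b B' n).hom =
    (αₗ _ _ n).hom ≫ (hbHomAct a b (B' ⊙ₗ n)).hom := rfl

lemma freeIso_naturality {n n' : M} (f : n ⟶ n') :
    (H.obj (F.functor.obj p) ⊗ B') ⊴ₗ f ≫ (freeIso a b B' n').hom =
      (freeIso a b B' n).hom ≫ F.functor.map (H.obj p ⊴ₗ B' ⊴ₗ f) := by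
  rw [freeIso_hom, freeIso_hom, ← reassoc_of% assoc_hom_naturality, hbHomAct_naturality]
  simp only [Category.assoc]

lemma freeIso_δ (G : RexMod k C M) (n : M) :
    G.functor.map (freeIso a b B' n).hom ≫ (hbIso b G (H.obj p ⊙ₗ B' ⊙ₗ n)).hom ≫
        F.functor.map (δₗ G.functor (H.obj p) (B' ⊙ₗ n) ≫ H.obj p ⊴ₗ δₗ G.functor B' n) =
      δₗ G.functor (H.obj (F.functor.obj p) ⊗ B') n ≫
        (freeIso a b B' (G.functor.obj n)).hom := by
  rw [freeIso_hom, freeIso_hom, reassoc_of% (δₗ_associativity G.functor), hbHomAct_naturality,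
    ← reassoc_of% hbHomAct_δ]
  simp only [Functor.map_comp, Category.assoc]

variable [ExactPairing B' (H.obj p)]

/-- The epimorphism `(Hom(p, F(p)) ⊗ B') ⊗ n ⟶ F(n)`. -/
def cover (n : M) : (H.obj (F.functor.obj p) ⊗ B') ⊙ₗ n ⟶ F.functor.obj n :=
  (freeIso a b B' n).hom ≫ F.functor.map (evAct B' (H.obj p) n)

lemma cover_naturality {n n' : M} (f : n ⟶ n') :
    (H.obj (F.functor.obj p) ⊗ B') ⊴ₗ f ≫ cover a b B' n' =
      cover a b B' n ≫ F.functor.map f := by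
  rw [cover, cover, reassoc_of% freeIso_naturality, Category.assoc, ← Functor.map_comp,
    ← Functor.map_comp, evAct_natural]

/-- Combines `freeIso_δ` with the fact that `G` preserves the evaluation (`δₗ_evAct`); the
isomorphism with the action of an object inherits this compatibility from `cover`. -/
lemma cover_δ (G : RexMod k C M) (n : M) :
    G.functor.map (cover a b B' n) ≫ (hbIso b G n).hom =
      δₗ G.functor (H.obj (F.functor.obj p) ⊗ B') n ≫ cover a b B' (G.functor.obj n) := by
  rw [cover, cover, ← reassoc_of% freeIso_δ, ← Functor.map_comp, Category.assoc, δₗ_evAct,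
    Functor.map_comp, Category.assoc, hbIso_naturality]

variable [MonoidalPreadditive C] [Simple (𝟙_ C)]

lemma epi_cover (hB : ¬ IsZero (H.obj p)) (n : M) : Epi (cover a b B' n) := by
  have := epi_of_nonzero_to_unit k (evaluation_ne_zero (X := H.obj p) (D := B') hB)
  have : Epi (evAct B' (H.obj p) n) := by
    have := epi_actionHomLeft k (ε_ B' (H.obj p)) n
    unfold evAct
    infer_instance
  have := F.toRex.property.rightExact
  unfold cover
  infer_instance

include a b in
omit [ExactPairing B' (H.obj p)] in
/-- An object of the center of the dual category is, as a functor that commutes with the dual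
category, the action of an object of the category that acts. -/
lemma exists_actionLeft_iso (hp : ¬ IsZero p) :
    ∃ (V : C) (e : ∀ n : M, V ⊙ₗ n ≅ F.functor.obj n),
      (∀ {n n' : M} (f : n ⟶ n'), V ⊴ₗ f ≫ (e n').hom = (e n).hom ≫ F.functor.map f) ∧
      ∀ (G : RexMod k C M) (n : M), G.functor.map (e n).hom ≫ (hbIso b G n).hom =
        δₗ G.functor V n ≫ (e (G.functor.obj n)).hom := by
  have hC : IsFiniteAbelian k C := inferInstance
  let _ := hC.abelian
  have hB : ¬ IsZero (H.obj p) := not_isZero_of_actionRight_adjunction k a (𝟙 p)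
    (fun h => hp ((IsZero.iff_id_eq_zero p).2 h))
  let B := H.obj p
  let B' : C := ᘁB
  let S := H.obj (F.functor.obj p) ⊗ B'
  let c (n : M) : S ⊙ₗ n ≅ F.functor.obj (B ⊙ₗ B' ⊙ₗ n) := freeIso a b B' n
  let π (n : M) : S ⊙ₗ n ⟶ F.functor.obj n := cover a b B' n
  have hπ (n : M) : π n = (c n).hom ≫ F.functor.map (evAct B' B n) := rfl
  have πn {n n' : M} (f : n ⟶ n') : S ⊴ₗ f ≫ π n' = π n ≫ F.functor.map f :=
    cover_naturality a b B' f
  have πδ (G : RexMod k C M) (n : M) : G.functor.map (π n) ≫ (hbIso b G n).hom =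
      δₗ G.functor S n ≫ π (G.functor.obj n) := cover_δ a b B' G n
  have cn {n n' : M} (f : n ⟶ n') : S ⊴ₗ f ≫ (c n').hom =
      (c n).hom ≫ F.functor.map (B ⊴ₗ B' ⊴ₗ f) := freeIso_naturality a b B' f
  have cδ (G : RexMod k C M) (n : M) :
      G.functor.map (c n).hom ≫ (hbIso b G (B ⊙ₗ B' ⊙ₗ n)).hom ≫
        F.functor.map (δₗ G.functor B (B' ⊙ₗ n) ≫ B ⊴ₗ δₗ G.functor B' n) =
      δₗ G.functor S n ≫ (c (G.functor.obj n)).hom := freeIso_δ a b B' G n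
  have πe (n : M) : Epi (π n) := epi_cover a b B' hB n
  have rexF := F.toRex.property.rightExact
  have addF := F.toRex.property.additive
  have addM (n : M) : (actionRight C n).Additive :=
    IsFiniteLeftModuleCategory.additive_actionRight k n
  have rexM (n : M) : PreservesFiniteColimits (actionRight C n) :=
    IsFiniteLeftModuleCategory.rightExact_actionRight k n
  have hz {X Y : C} (n : M) : (0 : X ⟶ Y) ⊵ₗ n = 0 := (actionRight C n).map_zero _ _
  have hε : Epi (ε_ B' B) := epi_of_nonzero_to_unit k (evaluation_ne_zero hB)
  -- The sequence `K ⟶ B ⊗ B' ⟶ 𝟙` stays right exact after acting on `n` and applying `F`, so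
  -- `F.functor.map (κ n)` gives the relations that define `F(n)`.
  let K := kernel (ε_ B' B)
  let κ (n : M) : K ⊙ₗ n ⟶ B ⊙ₗ B' ⊙ₗ n := kernel.ι (ε_ B' B) ⊵ₗ n ≫ (αₗ B B' n).hom
  have κn {n n' : M} (f : n ⟶ n') : K ⊴ₗ f ≫ κ n' = κ n ≫ B ⊴ₗ B' ⊴ₗ f := by
    simp only [κ, Category.assoc, assoc_hom_naturality, action_exchange_assoc]
  have κδ (G : RexMod k C M) (n : M) :
      G.functor.map (κ n) ≫ δₗ G.functor B (B' ⊙ₗ n) ≫ B ⊴ₗ δₗ G.functor B' n =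
        δₗ G.functor K n ≫ κ (G.functor.obj n) := by
    simp only [κ, Functor.map_comp, Category.assoc]
    rw [← δₗ_associativity, reassoc_of% (δₗ_naturality_left G.functor)]
  have κev (n : M) : κ n ≫ evAct B' B n = 0 := by
    simp only [κ, evAct, Category.assoc, Iso.hom_inv_id_assoc]
    rw [← comp_actionHomLeft_assoc, kernel.condition, hz, zero_comp]
  have descF {n W : M} (x : F.functor.obj (B ⊙ₗ B' ⊙ₗ n) ⟶ W)
      (hx : F.functor.map (κ n) ≫ x = 0) : ∃ y, F.functor.map (evAct B' B n) ≫ y = x := by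
    have := Limits.comp_preservesFiniteColimits (actionRight C n) F.functor
    obtain ⟨y, hy⟩ := exists_desc_of_preservesFiniteColimits (actionRight C n ⋙ F.functor)
      (w := kernel.condition (ε_ B' B))
      (Abelian.epiIsCokernelOfKernel (KernelFork.ofι _ (kernel.condition (ε_ B' B)))
        (kernelIsKernel (ε_ B' B)))
      (F.functor.map (αₗ B B' n).hom ≫ x)
      ((F.functor.map_comp_assoc _ _ _).symm.trans hx)
    have hy' : F.functor.map (ε_ B' B ⊵ₗ n) ≫ y = F.functor.map (αₗ B B' n).hom ≫ x := hy
    let y' : F.functor.obj (𝟙_ C ⊙ₗ n) ⟶ W := y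
    refine ⟨F.functor.map (λₗ n).inv ≫ y', ?_⟩
    rw [← Functor.map_comp_assoc, evAct, Category.assoc, Category.assoc, Iso.hom_inv_id,
      Category.comp_id, Functor.map_comp_assoc, hy', ← Functor.map_comp_assoc, Iso.inv_hom_id,
      CategoryTheory.Functor.map_id, Category.id_comp]
  -- the relations
  let ψ (n : M) : (S ⊗ K) ⊙ₗ n ⟶ S ⊙ₗ n :=
    (αₗ S K n).hom ≫ π (K ⊙ₗ n) ≫ F.functor.map (κ n) ≫ (c n).inv
  have hψ : IsCentral k ψ := by
    constructor
    · intro n n' f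
      rw [← cancel_mono (c n').hom]
      simp only [ψ, Category.assoc, Iso.inv_hom_id, Category.comp_id, cn, Iso.inv_hom_id_assoc]
      rw [← reassoc_of% assoc_hom_naturality, reassoc_of% πn, ← Functor.map_comp,
        ← Functor.map_comp, κn]
    · intro G n
      rw [← cancel_mono (c (G.functor.obj n)).hom, Category.assoc, Category.assoc]
      change G.functor.map (ψ n) ≫ δₗ G.functor S n ≫ (c (G.functor.obj n)).hom = _
      rw [← cδ]
      simp only [ψ, Category.assoc, Iso.inv_hom_id, Category.comp_id]
      rw [← Functor.map_comp_assoc, Category.assoc, Category.assoc, Category.assoc,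
        Iso.inv_hom_id, Category.comp_id, Functor.map_comp, Functor.map_comp, Category.assoc,
        Category.assoc, reassoc_of% hbIso_naturality, ← Functor.map_comp, κδ, reassoc_of% πδ,
        Functor.map_comp, ← reassoc_of% πn, ← δₗ_associativity_assoc]
  -- By the double centralizer property the relations come from a morphism of `C`; its cokernel is
  -- the required object.
  obtain ⟨j, hj⟩ := hψ.exists_eq a hp
  let q : S ⟶ cokernel j := cokernel.π j
  have hq (n : M) : Epi (q ⊵ₗ n) := epi_actionHomLeft k q n
  have hv (n : M) : ∃ v : cokernel j ⊙ₗ n ⟶ F.functor.obj n, q ⊵ₗ n ≫ v = π n := by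
    refine exists_desc_of_preservesFiniteColimits (actionRight C n) (w := cokernel.condition j)
      (cokernelIsCokernel j) (π n) ?_
    change j ⊵ₗ n ≫ π n = 0
    simp only [← hj, ψ, hπ n, Category.assoc, Iso.inv_hom_id_assoc]
    rw [← Functor.map_comp, κev, Functor.map_zero, comp_zero, comp_zero]
  -- For the inverse, `q ⊵ₗ n` must kill the relations `F(K ⊗ n)`. This can be checked after the
  -- epimorphism `π (K ⊙ₗ n)`, where they become `ψ n`.
  have hu (n : M) : ∃ u : F.functor.obj n ⟶ cokernel j ⊙ₗ n, π n ≫ u = q ⊵ₗ n := by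
    obtain ⟨u, hu⟩ := descF ((c n).inv ≫ q ⊵ₗ n) (by
      have h : ψ n ≫ q ⊵ₗ n = 0 := by
        rw [hj, ← comp_actionHomLeft, cokernel.condition, hz]
      rw [← cancel_epi (π (K ⊙ₗ n)), ← cancel_epi (αₗ S K n).hom, comp_zero, comp_zero, ← h]
      simp only [ψ, Category.assoc])
    exact ⟨u, by rw [hπ, Category.assoc, hu, Iso.hom_inv_id_assoc]⟩
  choose v hv using hv
  choose u hu using hu
  refine ⟨cokernel j, fun n =>
    { hom := v n
      inv := u n
      hom_inv_id := by rw [← cancel_epi (q ⊵ₗ n), reassoc_of% hv, hu, Category.comp_id]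
      inv_hom_id := by rw [← cancel_epi (π n), reassoc_of% hu, hv, Category.comp_id] }, ?_, ?_⟩
  · intro n n' f
    rw [← cancel_epi (q ⊵ₗ n), ← action_exchange_assoc, hv, reassoc_of% hv, πn]
  · intro G n
    have := G.toRex.property.rightExact
    rw [← cancel_epi (G.functor.map (q ⊵ₗ n)), ← Functor.map_comp_assoc, hv, πδ,
      reassoc_of% (δₗ_naturality_left G.functor), hv]

end Descent
end FinTensor

namespace FinTensor
open MonoidalLeftAction Functor.LaxLeftLinear Functor.OplaxLeftLinear

/-! ### Isomorphisms and half-braidings from central families. -/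

section CentralIso
variable {k : Type v} [Field k]
  {C : Type u₁} [Category.{v} C] [MonoidalCategory C] [Preadditive C] [Linear k C]
  [MonoidalPreadditive C] [RigidCategory C] [IsFiniteAbelian k C] [Simple (𝟙_ C)]
  {M : Type u₂} [Category.{v} M] [Preadditive M] [Linear k M] [MonoidalLeftAction C M]
  [IsFiniteLeftModuleCategory k C M]

omit [Preadditive C] [Linear k C] [MonoidalPreadditive C] [RigidCategory C]
  [IsFiniteAbelian k C] [Simple (𝟙_ C)] [IsFiniteLeftModuleCategory k C M] in
lemma IsCentral.symm {X Y : C} {ψ : ∀ m : M, X ⊙ₗ m ≅ Y ⊙ₗ m}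
    (hψ : IsCentral k fun m => (ψ m).hom) : IsCentral k fun m => (ψ m).inv where
  naturality {m m'} f := by
    rw [← cancel_mono (ψ m').hom, ← cancel_epi (ψ m).hom]
    have := hψ.naturality f
    simp [this]
  comm G m := by
    have e := hψ.comm G m
    rw [← cancel_mono (ψ (G.toRex.obj.obj m)).hom, ← cancel_epi (G.toRex.obj.map (ψ m).hom)]
    simp only [Category.assoc, Iso.inv_hom_id, Category.comp_id]
    rw [← Functor.map_comp_assoc, Iso.hom_inv_id, CategoryTheory.Functor.map_id, Category.id_comp]
    exact e.symm

/-- Both directions come from `C` by the double centralizer property, and faithfulness makes them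
mutually inverse. -/
lemma IsCentral.exists_iso {p : M} [Projective p] {H : M ⥤ C} (a : actionRight C p ⊣ H)
    (hp : ¬ IsZero p) {X Y : C} {ψ : ∀ m : M, X ⊙ₗ m ≅ Y ⊙ₗ m}
    (hψ : IsCentral k fun m => (ψ m).hom) :
    ∃ f : X ≅ Y, ∀ m, f.hom ⊵ₗ m = (ψ m).hom := by
  obtain ⟨f, hf⟩ := hψ.exists_eq a hp
  obtain ⟨g, hg⟩ := hψ.symm.exists_eq a hp
  refine ⟨⟨f, g, ?_, ?_⟩, fun m => (hf m).symm⟩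
  · refine actionHomLeft_ext k (M := M) ⟨p, hp⟩ fun m => ?_
    rw [comp_actionHomLeft, ← hf, ← hg, Iso.hom_inv_id, id_actionHomLeft]
  · refine actionHomLeft_ext k (M := M) ⟨p, hp⟩ fun m => ?_
    rw [comp_actionHomLeft, ← hf, ← hg, Iso.inv_hom_id, id_actionHomLeft]

include k in
variable (k) in
/-- A half-braiding is determined by the isomorphisms `V ⊗ X ⊗ m ≅ X ⊗ V ⊗ m`, which may be
prescribed if they are natural, satisfy the hexagon condition and come from isomorphisms
`V ⊗ X ≅ X ⊗ V`. -/
lemma exists_halfBraiding (hM : ∃ m : M, ¬ IsZero m) {V : C}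
    (s : ∀ (X : C) (m : M), V ⊙ₗ X ⊙ₗ m ≅ X ⊙ₗ V ⊙ₗ m)
    (h₁ : ∀ {X Y : C} (f : X ⟶ Y) (m : M),
      V ⊴ₗ f ⊵ₗ m ≫ (s Y m).hom = (s X m).hom ≫ f ⊵ₗ (V ⊙ₗ m))
    (h₂ : ∀ (X Y : C) (m : M), (s (X ⊗ Y) m).hom ≫ (αₗ X Y (V ⊙ₗ m)).hom =
      V ⊴ₗ (αₗ X Y m).hom ≫ (s X (Y ⊙ₗ m)).hom ≫ X ⊴ₗ (s Y m).hom)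
    (h₃ : ∀ X : C, ∃ f : V ⊗ X ≅ X ⊗ V, ∀ m : M,
      f.hom ⊵ₗ m = (αₗ V X m).hom ≫ (s X m).hom ≫ (αₗ X V m).inv) :
    ∃ b : HalfBraiding V, ∀ (X : C) (m : M), (braidAct b X m).hom = (s X m).hom := by
  choose β hβ using h₃
  refine ⟨{ β := β, monoidal := fun X Y => ?_, naturality := fun {X Y} f => ?_ }, fun X m => ?_⟩
  · refine actionHomLeft_ext k (M := M) hM fun m => ?_
    have e := h₂ X Y m
    rw [← Iso.eq_comp_inv] at e
    rw [hβ, e]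
    simp only [comp_actionHomLeft, whiskerLeft_actionHomLeft, whiskerRight_actionHomLeft,
      associator_act, associator_inv_act, hβ, actionHomRight_comp, Category.assoc,
      Iso.inv_hom_id_assoc]
    simp
  · refine actionHomLeft_ext k (M := M) hM fun m => ?_
    simp only [comp_actionHomLeft, whiskerLeft_actionHomLeft, whiskerRight_actionHomLeft, hβ,
      Category.assoc, Iso.inv_hom_id_assoc, reassoc_of% h₁]
  · simp [braidAct_hom, hβ]

end CentralIso

/-! ### Schauenburg's functor is faithful, full and essentially surjective. -/

section Equivalence
variable {k : Type v} [Field k]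
  {C : Type u₁} [Category.{v} C] [MonoidalCategory C] [Preadditive C] [Linear k C]
  [MonoidalPreadditive C] [RigidCategory C] [IsFiniteAbelian k C] [Simple (𝟙_ C)]
  {M : Type u₂} [Category.{v} M] [Preadditive M] [Linear k M] [MonoidalLeftAction C M]
  [IsFiniteLeftModuleCategory k C M]
  {p : M}

lemma faithful_schauenburg (hM : ∃ m : M, ¬ IsZero m) : (schauenburg k C M).Faithful where
  map_injective {V W} _ _ h := Center.ext _ _ (actionHomLeft_ext k hM fun m =>
    congrArg (fun t : (schauenburg k C M).obj V ⟶ (schauenburg k C M).obj W =>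
      t.f.nat.hom.app m) h)

variable [Projective p] {H : M ⥤ C} (a : actionRight C p ⊣ H) (hp : ¬ IsZero p)
include a hp

/-- Compatibility with the half-braidings is centrality, which produces `f`; compatibility with the
module structures then says that `f` respects the half-braidings of `V` and `W`. -/
lemma full_schauenburg : (schauenburg k C M).Full where
  map_surjective {V W} φ := by
    let ψ (m : M) : V.1 ⊙ₗ m ⟶ W.1 ⊙ₗ m := φ.f.nat.hom.app m
    have hψ : IsCentral k ψ :=
      { naturality := fun f => φ.f.nat.hom.naturality f
        comm := fun G m => congrArg (fun t => t.nat.hom.app m) (φ.comm G) }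
    obtain ⟨f, hf⟩ := hψ.exists_eq a hp
    have hc (X : C) (m : M) : X ⊴ₗ f ⊵ₗ m ≫ (braidAct W.2 X m).inv =
        (braidAct V.2 X m).inv ≫ f ⊵ₗ (X ⊙ₗ m) := by
      rw [← hf, ← hf]
      exact φ.f.comm X m
    refine ⟨⟨f, fun X => actionHomLeft_ext k (M := M) ⟨p, hp⟩ fun m => ?_⟩, ?_⟩
    · have e := hc X m
      rw [Iso.comp_inv_eq, Category.assoc, Iso.eq_inv_comp] at e
      have e' := congrArg ((αₗ V.1 X m).hom ≫ · ≫ (αₗ X W.1 m).inv) e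
      simp only [braidAct_hom, Category.assoc, Iso.hom_inv_id_assoc, Iso.hom_inv_id,
        Category.comp_id] at e'
      simp only [comp_actionHomLeft, whiskerLeft_actionHomLeft, whiskerRight_actionHomLeft,
        Category.assoc]
      exact e'.symm
    · refine Center.ext _ _ (RexMod.hom_ext fun m => ?_)
      exact (hf m).symm

/-- Transporting the module structure of `F` along `V ⊗ - ≅ F` gives a central family, which
faithfulness upgrades to a half-braiding of `V`. -/
lemma essSurj_schauenburg : (schauenburg k C M).EssSurj where
  mem_essImage Z := by
    obtain ⟨F, b⟩ := Z
    obtain ⟨V, e, en, eδ⟩ := exists_actionLeft_iso a b hp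
    let s (X : C) (m : M) : V ⊙ₗ X ⊙ₗ m ≅ X ⊙ₗ V ⊙ₗ m :=
      e (X ⊙ₗ m) ≪≫ (Functor.LeftLinear.μₗIso F.functor X m).symm ≪≫
        (actionLeft M X).mapIso (e m).symm
    have hs (X : C) (m : M) : (s X m).hom ≫ X ⊴ₗ (e m).hom =
        (e (X ⊙ₗ m)).hom ≫ δₗ F.functor X m := by
      change ((e (X ⊙ₗ m)).hom ≫ δₗ F.functor X m ≫ X ⊴ₗ (e m).inv) ≫ X ⊴ₗ (e m).hom = _
      rw [Category.assoc, Category.assoc, actionHomRight_inv_hom, Category.comp_id]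
    have hn (X : C) {m m' : M} (f : m ⟶ m') :
        V ⊴ₗ X ⊴ₗ f ≫ (s X m').hom = (s X m).hom ≫ X ⊴ₗ V ⊴ₗ f := by
      rw [← cancel_mono (X ⊴ₗ (e m').hom), Category.assoc, Category.assoc, hs,
        ← actionHomRight_comp, en, actionHomRight_comp, reassoc_of% hs, reassoc_of% en,
        δₗ_naturality_right]
    -- The family commutes with `G` because `e` intertwines the half-braiding of `F` with `δₗ`, and
    -- that half-braiding consists of module functor morphisms (`hbIso_δ`).
    have hc (G : RexMod k C M) (X : C) (m : M) :
        G.functor.map (s X m).hom ≫ δₗ G.functor X (V ⊙ₗ m) ≫ X ⊴ₗ δₗ G.functor V m =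
          δₗ G.functor V (X ⊙ₗ m) ≫ V ⊴ₗ δₗ G.functor X m ≫ (s X (G.functor.obj m)).hom := by
      rw [← cancel_mono (X ⊴ₗ (e (G.functor.obj m)).hom)]
      simp only [Category.assoc]
      rw [hs, reassoc_of% en, ← actionHomRight_comp, ← eδ, actionHomRight_comp,
        ← δₗ_naturality_right_assoc, ← Functor.map_comp_assoc, hs, Functor.map_comp_assoc,
        ← hbIso_δ, reassoc_of% eδ]
    have hs' (X : C) : IsCentral k (fun m : M =>
        (αₗ V X m ≪≫ s X m ≪≫ (αₗ X V m).symm).hom) :=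
      { naturality := fun {m m'} f => by
          simp only [Iso.trans_hom, Iso.symm_hom, Category.assoc]
          rw [← reassoc_of% assoc_hom_naturality, reassoc_of% hn, assoc_inv_naturality]
        comm := fun G m => by
          rw [← cancel_mono (αₗ X V (G.functor.obj m)).hom]
          simp only [Iso.trans_hom, Iso.symm_hom, Category.assoc, Iso.inv_hom_id,
            Category.comp_id]
          rw [δₗ_associativity, ← Functor.map_comp_assoc, Category.assoc, Category.assoc,
            Iso.inv_hom_id, Category.comp_id, Functor.map_comp_assoc, hc,
            ← δₗ_associativity_assoc] }
    obtain ⟨σ, hσ⟩ := exists_halfBraiding k ⟨p, hp⟩ s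
      (fun {X Y} f m => by
        rw [← cancel_mono (Y ⊴ₗ (e m).hom), Category.assoc, Category.assoc, hs,
          reassoc_of% en, δₗ_naturality_left, ← action_exchange, reassoc_of% hs])
      (fun X Y m => by
        rw [← cancel_mono (X ⊴ₗ Y ⊴ₗ (e m).hom)]
        simp only [Category.assoc]
        rw [assoc_hom_naturality, ← actionHomRight_comp, hs, reassoc_of% hs,
          actionHomRight_comp, reassoc_of% hs, δₗ_associativity, reassoc_of% en])
      (fun X => by
        obtain ⟨f, hf⟩ := (hs' X).exists_iso a hp
        exact ⟨f, fun m => by simp [hf]⟩)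
    have hi (X : C) (m : M) : X ⊴ₗ (e m).hom ≫ μₗ F.functor X m =
        (braidAct σ X m).inv ≫ (e (X ⊙ₗ m)).hom := by
      rw [Iso.eq_inv_comp, hσ, reassoc_of% hs, Functor.LeftLinear.δₗ_comp_μₗ, Category.comp_id]
    let i : braidedAct k M σ ≅ F := RexMod.isoMk e (fun f => en f) hi
    let φ : (schauenburg k C M).obj ⟨V, σ⟩ ⟶ ⟨F, b⟩ :=
      { f := i.hom
        comm := fun G => RexMod.hom_ext fun m => eδ G m }
    have : IsIso φ.f := inferInstanceAs (IsIso i.hom)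
    exact ⟨⟨V, σ⟩, ⟨Center.isoMk φ⟩⟩

end Equivalence
end FinTensor

namespace FinTensor

/-! ### Assembly of the theorem. -/

section Main
variable {k : Type v} [Field k]
  {C : Type u₁} [Category.{v} C] [MonoidalCategory C] [Preadditive C] [Linear k C]
  [MonoidalPreadditive C] [RigidCategory C] [IsFiniteAbelian k C] [Simple (𝟙_ C)]
  {M : Type u₂} [Category.{v} M] [Preadditive M] [Linear k M] [MonoidalLeftAction C M]
  [IsFiniteLeftModuleCategory k C M]

/-- Schauenburg's functor is an equivalence for a nonzero module category. -/
lemma isEquivalence_schauenburg (hM : ∃ m : M, ¬ IsZero m) :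
    (schauenburg k C M).IsEquivalence := by
  obtain ⟨m, hm⟩ := hM
  have hMf : IsFiniteAbelian k M := IsFiniteLeftModuleCategory.finiteAbelian C
  obtain ⟨p, _, hp⟩ := hMf.exists_projective_separator
  -- A zero separator would force every object to be zero.
  have hp0 : ¬ IsZero p := fun h => hm ((IsZero.iff_id_eq_zero m).2
    (eq_zero_of_separator hp _ fun f => h.eq_of_src _ _))
  have := isLeftAdjoint_actionRight (C := C) k p
  let a := Adjunction.ofIsLeftAdjoint (MonoidalLeftAction.actionRight C p)
  have := faithful_schauenburg (k := k) (C := C) (M := M) ⟨p, hp0⟩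
  have := full_schauenburg (k := k) a hp0
  have := essSurj_schauenburg (k := k) a hp0
  exact {}

/-- The underlying adjunction of the composite of Schauenburg's functor and the forgetful functor. -/
def schauenburgForgetAdjunction {R : Rex k M ⥤ C} (adj : act k C M ⊣ R) :
    schauenburg k C M ⋙ Center.forget (RexMod k C M) ⊣ radjCenter adj :=
  (centerAdjunction adj).ofNatIsoLeft (NatIso.ofComponents (fun _ => Iso.refl _)
    fun _ => (Category.comp_id _).trans (Category.id_comp _).symm)

end Main
end FinTensor

theorem mainTheorem2 {k : Type v} [Field k] [IsAlgClosed k]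
    {C : Type u₁} [Category.{v} C] [MonoidalCategory C] [Preadditive C] [Linear k C]
    [MonoidalPreadditive C] [MonoidalLinear k C] [RigidCategory C]
    [FinTensor.IsFiniteAbelian k C] [Simple (𝟙_ C)]
    {M : Type u₂} [Category.{v} M] [Preadditive M] [Linear k M] [MonoidalLeftAction C M]
    [FinTensor.IsFiniteLeftModuleCategory k C M] :
    (FinTensor.act k C M).IsLeftAdjoint ∧
    (∃ H : Mᵒᵖ ⥤ M ⥤ C, Nonempty ((MonoidalLeftAction.curriedAction C M).flip ⊣₂ H)) ∧
    ∀ (R : FinTensor.Rex k M ⥤ C) (adj : FinTensor.act k C M ⊣ R),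
      (∃ adjZ : FinTensor.centerAct k C M ⊣ FinTensor.radjCenter adj,
        (∀ V : Center C, (adjZ.unit.app V).f = adj.unit.app V.1) ∧
        (∀ F : FinTensor.RexMod k C M, (adjZ.counit.app F).nat = adj.counit.app F.toRex)) ∧
      Nonempty (FinTensor.schauenburg k C M ⋙ Center.forget (FinTensor.RexMod k C M) ⊣
        FinTensor.radjCenter adj) ∧
      (∀ (H : Mᵒᵖ ⥤ M ⥤ C) (hadj : (MonoidalLeftAction.curriedAction C M).flip ⊣₂ H)
        (F : FinTensor.Rex k M), Nonempty (IsLimit (FinTensor.counitWedge adj hadj F))) ∧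
      ((∃ m : M, ¬ IsZero m) →
        (FinTensor.schauenburg k C M).IsEquivalence ∧
        (Center.forget (FinTensor.RexMod k C M)).IsLeftAdjoint ∧
        ∀ (I : FinTensor.RexMod k C M ⥤ Center (FinTensor.RexMod k C M))
          (_adjI : Center.forget (FinTensor.RexMod k C M) ⊣ I)
          (Θ : Center C ≌ Center (FinTensor.RexMod k C M))
          (_e : Θ.functor ≅ FinTensor.schauenburg k C M),
          Nonempty (I ⋙ Θ.inverse ≅ FinTensor.radjCenter adj) ∧
          ∀ (H : Mᵒᵖ ⥤ M ⥤ C) (_hadj : (MonoidalLeftAction.curriedAction C M).flip ⊣₂ H)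
            (F : FinTensor.RexMod k C M),
            ∃ w : Wedge (FinTensor.ihomFunctor H F.toRex.obj),
              w.pt = (Center.forget C).obj (Θ.inverse.obj (I.obj F)) ∧
              Nonempty (IsLimit w)) := by
  refine ⟨FinTensor.isLeftAdjoint_act k C M, FinTensor.exists_parametrizedAdjunction _
    (fun m => FinTensor.isLeftAdjoint_actionRight (C := C) k m), fun R adj =>
    ⟨⟨FinTensor.centerAdjunction adj, fun _ => rfl, fun _ => rfl⟩,
      ⟨FinTensor.schauenburgForgetAdjunction adj⟩,
      fun H hadj F => ⟨FinTensor.isLimitCounitWedge adj hadj F⟩, fun hM => ?_⟩⟩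
  have := FinTensor.isEquivalence_schauenburg (k := k) (C := C) hM
  refine ⟨this, ?_, fun I adjI Θ e => ?_⟩
  -- Up to the inverse of an equivalence, the forgetful functor is `U ∘ Θ`, which has a right
  -- adjoint.
  · let E := (FinTensor.schauenburg k C M).asEquivalence
    exact ((E.symm.toAdjunction.comp (FinTensor.schauenburgForgetAdjunction adj)).ofNatIsoLeft
      (E.invFunIdAssoc _)).isLeftAdjoint
  -- Both sides are right adjoint to the composite of Schauenburg's functor with the forgetful
  -- functor.
  · let i : I ⋙ Θ.inverse ≅ FinTensor.radjCenter adj :=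
      ((Θ.toAdjunction.comp adjI).ofNatIsoLeft (Functor.isoWhiskerRight e _)).rightAdjointUniq
        (FinTensor.schauenburgForgetAdjunction adj)
    refine ⟨⟨i⟩, fun H hadj F => ?_⟩
    let j : (Center.forget C).obj (Θ.inverse.obj (I.obj F)) ≅ R.obj F.toRex :=
      (Center.forget C).mapIso (i.app F)
    let c := FinTensor.counitWedge adj hadj F.toRex
    -- The universal wedge of the counit, transported along `j` so that its vertex is the required
    -- object on the nose.
    refine ⟨Wedge.mk _ (fun m => j.hom ≫ c.ι m) (fun m m' f => ?_), rfl,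
      ⟨(FinTensor.isLimitCounitWedge adj hadj F.toRex).ofIsoLimit (Wedge.ext j.symm fun m => ?_)⟩⟩
    · exact (Category.assoc _ _ _).trans ((congrArg (j.hom ≫ ·) (c.condition f)).trans
        (Category.assoc _ _ _).symm)
    · exact (j.inv_hom_id_assoc (c.ι m)).symm
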